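/- Fix $d$ and compact metric spaces $X,Y$ of labels. A labeled Delone set is the graph $\Lambda$ of a map from a Delone set of $\mathbb R^d$ (uniformly discrete and relatively dense) to a label space. (Tilings are encoded in this way by puncturing their tiles.) Labeled Delone sets carry the topology in which $\Lambda,\Lambda'$ are close if, for a small $\varepsilon>0$, they correspond one-to-one on the ball of radius $1/\varepsilon$ up to moving points and labels by less than $\varepsilon$. The tiling space (hull) of $\Lambda$ is $\Omega=\overline{\{\Lambda-x : x\in\mathbb R^d\}}$ with the translation action $T\mapsto T-x$. $\Lambda$ has finite local complexity (FLC) if for every radius it has finitely many patches up to translation. A function on $\Omega$ is strongly pattern-equivariant (PE) if, for some $R$, its value at $T$ depends only on $T\cap B(0,R)$. *Cohomology.* A weak 1-cocycle is a continuous $\alpha:\Omega\times\mathbb R^d\to\mathbb R^d$ with $\alpha(T,x)+\alpha(T-x,y)=\alpha(T,x+y)$. It is strong if $\alpha(\cdot,v)$ is strongly PE for every $v$. Weak (resp. strong) coboundaries are the cocycles $\delta s(T,v)=s(T-v)-s(T)$ with $s:\Omega\to\mathbb R^d$ continuous (resp. continuous and strongly PE). The quotients are $H^1_w(\Omega;\mathbb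 R^d)$ and $H^1_s(\Omega;\mathbb R^d)$. *Ruelle–Sullivan map.* A closed weakly PE 1-form is a map $\omega:\Omega\to\mathrm{End}(\mathbb R^d)$ such that, for each $T$, $x\mapsto\omega(T-x)$ is a smooth closed $\mathbb R^d$-valued 1-form on $\mathbb R^d$, and such that all derivatives of these forms (including order $0$), evaluated at $x=0$, depend continuously on $T$. It corresponds to the cocycle $\alpha$ for which $\alpha(T,\cdot)$ is the primitive of $x\mapsto\omega(T-x)$ vanishing at $0$, and it represents the class of $\alpha$; classes in $H^1_s$ are represented by strongly PE forms with a strong cocycle. For an invariant probability measure $\mu$ on $\Omega$, $C_\mu(c)=\int_\Omega\omega\,d\mu$ (a $d\times d$ matrix) for any form $\omega$ representing $c$. *The class of $h$.* Let $h:\Omega\to\Omega'$ be a homeomorphism. It is an orbit equivalence if it maps every $\mathbb R^d$-orbit onto an $\mathbb R^d$-orbit; then $[h]\in H^1_w(\Omega;\mathbb R^d)$ is the class of the cocycle $(T,x)\mapsto h_T(x)$ defined by $h(T-x)=h(T)-h_T(x)$. If $\Omega$ and $\Omega'$ have FLC, every homeomorphism is an orbit equivalence, and it has in addition a strong class $[h]\in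 H^1_s(\Omega;\mathbb R^d)$: the class of the cocycle of any map $h_s(T)=h(T)-s(T)$, $s:\Omega\to\mathbb R^d$ continuous, which is local (for every $r>0$ there is $R>0$ such that $T\cap B(0,R)$ determines $h_s(T)\cap B(0,r)$). **Theorem.** Let $\Omega$ and $\Omega'$ be the tiling spaces of labeled Delone sets $\Lambda,\Lambda'$ of $\mathbb R^d$ with labels in $X$ and $Y$. Suppose that both spaces are minimal (every orbit is dense) and aperiodic (no element has a nonzero period), and that $\Omega$ is uniquely ergodic, with invariant probability measure $\mu$. Let $h:\Omega\to\Omega'$ be a homeomorphism, and suppose that $h$ is an orbit equivalence or that both $\Lambda$ and $\Lambda'$ have FLC. Then the class $[h]\in H^1_w(\Omega;\mathbb R^d)$ and its Ruelle–Sullivan matrix $C_\mu[h]$ are well defined, and $C_\mu[h]$ is invertible. If both $\Lambda$ and $\Lambda'$ have FLC, then the strong class $[h]\in H^1_s(\Omega;\mathbb R^d)$ and its Ruelle–Sullivan matrix are also well defined, and that matrix is the same invertible matrix. -/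

import Mathlib

open MeasureTheory Topology
open scoped ContDiff

noncomputable section

namespace Tiling

/-- Euclidean `d`-space. -/
abbrev Euc (d : ℕ) : Type := EuclideanSpace ℝ (Fin d)

variable {d : ℕ} {X Y : Type*} [MetricSpace X] [MetricSpace Y]

/-- A labeled Delone set of `ℝ^d` with labels in `X`, given as the graph of its label map, i.e. as
the set of pairs (point, label). Uniform discreteness is imposed on distinct elements of the graph,
so it also says that every point carries exactly one label. -/
@[ext]
structure DeloneSet (d : ℕ) (X : Type*) [MetricSpace X] where
  carrier : Set (Euc d × X)
  uniformlyDiscrete : ∃ r > 0, ∀ p ∈ carrier, ∀ q ∈ carrier, p ≠ q → r ≤ dist p.1 q.1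
  relativelyDense : ∃ R > 0, ∀ x : Euc d, ∃ p ∈ carrier, dist p.1 x < R

namespace DeloneSet

/-- The translate `Λ - x`; labels are carried along. -/
def translate (Λ : DeloneSet d X) (x : Euc d) : DeloneSet d X where
  carrier := {p | (p.1 + x, p.2) ∈ Λ.carrier}
  uniformlyDiscrete := by
    obtain ⟨r, hr, h⟩ := Λ.uniformlyDiscrete
    refine ⟨r, hr, fun p hp q hq hpq => ?_⟩
    have := h _ hp _ hq (fun he => hpq (by
      have h1 := congrArg Prod.fst he
      have h2 := congrArg Prod.snd he
      exact Prod.ext (add_right_cancel h1) h2))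
    simpa using this
  relativelyDense := by
    obtain ⟨R, hR, h⟩ := Λ.relativelyDense
    refine ⟨R, hR, fun y => ?_⟩
    obtain ⟨p, hp, hd⟩ := h (y + x)
    refine ⟨(p.1 - x, p.2), by simpa using hp, ?_⟩
    rw [dist_eq_norm] at hd ⊢
    simpa [sub_sub, add_comm] using hd

instance : HSub (DeloneSet d X) (Euc d) (DeloneSet d X) := ⟨translate⟩

theorem mem_sub {Λ : DeloneSet d X} {x : Euc d} {p : Euc d × X} :
    p ∈ (Λ - x).carrier ↔ (p.1 + x, p.2) ∈ Λ.carrier := Iff.rfl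

theorem sub_sub_eq (Λ : DeloneSet d X) (x y : Euc d) : Λ - x - y = Λ - (x + y) := by
  ext p
  simp only [mem_sub, add_assoc, add_comm x y]

/-- The patch of `Λ` in the open ball of radius `R` about the origin. -/
def patch (Λ : DeloneSet d X) (R : ℝ) : Set (Euc d × X) := {p ∈ Λ.carrier | ‖p.1‖ < R}

theorem patch_mono {Λ Λ' : DeloneSet d X} {r R : ℝ} (h : r ≤ R)
    (hp : Λ.patch R = Λ'.patch R) : Λ.patch r = Λ'.patch r := by
  ext p
  have := Set.ext_iff.1 hp p
  simp only [patch, Set.mem_ofPred_eq] at this ⊢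
  constructor
  · rintro ⟨a, b⟩
    exact ⟨(this.1 ⟨a, b.trans_le h⟩).1, b⟩
  · rintro ⟨a, b⟩
    exact ⟨(this.2 ⟨a, b.trans_le h⟩).1, b⟩

/-- Finite local complexity: for every radius, there are finitely many patches of that radius
up to translation. -/
def IsFLC (Λ : DeloneSet d X) : Prop :=
  ∀ R : ℝ, ∃ S : Set (Set (Euc d × X)), S.Finite ∧
    ∀ x : Euc d, ∃ P ∈ S, ∃ y : Euc d, (Λ - x).patch R = (fun p => (p.1 + y, p.2)) '' P

/-- There is a one-to-one map from the part of `Λ` in the ball of radius `1/ε` to `Λ'` that moves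
points and labels by less than `ε`. -/
def MatchesInto (ε : ℝ) (Λ Λ' : DeloneSet d X) : Prop :=
  ∃ φ : Euc d × X → Euc d × X, Set.InjOn φ (Λ.patch ε⁻¹) ∧
    ∀ p ∈ Λ.patch ε⁻¹, φ p ∈ Λ'.carrier ∧ dist (φ p).1 p.1 < ε ∧ dist (φ p).2 p.2 < ε

/-- The basic entourages: `Λ` and `Λ'` correspond to each other on the ball of radius `1/ε`, up to
displacements of points and changes of labels smaller than `ε`. -/
def entourage (d : ℕ) (X : Type*) [MetricSpace X] (ε : ℝ) : Set (DeloneSet d X × DeloneSet d X) :=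
  {z | MatchesInto ε z.1 z.2 ∧ MatchesInto ε z.2 z.1}

theorem MatchesInto.mono {ε δ : ℝ} (hε : 0 < ε) (h : ε ≤ δ) {Λ Λ' : DeloneSet d X}
    (hm : MatchesInto ε Λ Λ') : MatchesInto δ Λ Λ' := by
  obtain ⟨φ, hi, hφ⟩ := hm
  have hs : Λ.patch δ⁻¹ ⊆ Λ.patch ε⁻¹ := fun p hp =>
    ⟨hp.1, hp.2.trans_le (inv_anti₀ hε h)⟩
  exact ⟨φ, hi.mono hs, fun p hp => ⟨(hφ p (hs hp)).1, (hφ p (hs hp)).2.1.trans_le h,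
    (hφ p (hs hp)).2.2.trans_le h⟩⟩

theorem MatchesInto.refl {ε : ℝ} (hε : 0 < ε) (Λ : DeloneSet d X) : MatchesInto ε Λ Λ :=
  ⟨id, Set.injOn_id _, fun p hp => ⟨hp.1, by simpa, by simpa⟩⟩

theorem MatchesInto.comp {ε δ : ℝ} (hδ : 0 < δ) (hδε : 2 * δ ≤ ε) (hδ1 : 2 * δ ≤ 1)
    {Λ Λ' Λ'' : DeloneSet d X} (h : MatchesInto δ Λ Λ') (h' : MatchesInto δ Λ' Λ'') :
    MatchesInto ε Λ Λ'' := by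
  obtain ⟨φ, hi, hφ⟩ := h
  obtain ⟨ψ, hj, hψ⟩ := h'
  have h2 : (1 : ℝ) ≤ δ⁻¹ / 2 := by
    rw [le_div_iff₀ two_pos, le_inv_comm₀ (by norm_num) hδ]; linarith
  have h3 : ε⁻¹ ≤ δ⁻¹ / 2 := by
    have := inv_anti₀ (by positivity) hδε
    rw [mul_inv] at this; linarith
  have hs : Λ.patch ε⁻¹ ⊆ Λ.patch δ⁻¹ := fun p hp => ⟨hp.1, by
    have := hp.2
    linarith⟩
  have hm : ∀ p ∈ Λ.patch ε⁻¹, φ p ∈ Λ'.patch δ⁻¹ := fun p hp => by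
    obtain ⟨a, b, -⟩ := hφ p (hs hp)
    refine ⟨a, ?_⟩
    have h4 := norm_le_norm_add_norm_sub' (φ p).1 p.1
    rw [dist_eq_norm] at b
    have := hp.2
    linarith
  refine ⟨ψ ∘ φ, fun p hp q hq he => hi (hs hp) (hs hq) (hj (hm p hp) (hm q hq) he),
    fun p hp => ?_⟩
  obtain ⟨-, b, c⟩ := hφ p (hs hp)
  obtain ⟨a', b', c'⟩ := hψ _ (hm p hp)
  refine ⟨a', ?_, ?_⟩
  · have := dist_triangle (ψ (φ p)).1 (φ p).1 p.1
    simp only [Function.comp]; linarith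
  · have := dist_triangle (ψ (φ p)).2 (φ p).2 p.2
    simp only [Function.comp]; linarith

theorem MatchesInto.sub {ε δ : ℝ} (hδε : δ ≤ ε) (x : Euc d)
    (hx : ε⁻¹ + ‖x‖ ≤ δ⁻¹) {Λ Λ' : DeloneSet d X} (h : MatchesInto δ Λ Λ') :
    MatchesInto ε (Λ - x) (Λ' - x) := by
  obtain ⟨φ, hi, hφ⟩ := h
  have hm : ∀ p ∈ (Λ - x).patch ε⁻¹, (p.1 + x, p.2) ∈ Λ.patch δ⁻¹ := fun p hp =>
    ⟨hp.1, by
      have := hp.2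
      have := norm_add_le p.1 x
      simp only; linarith⟩
  refine ⟨fun p => ((φ (p.1 + x, p.2)).1 - x, (φ (p.1 + x, p.2)).2), ?_, fun p hp => ?_⟩
  · intro p hp q hq he
    have h1 := congrArg Prod.fst he
    have h2 := congrArg Prod.snd he
    have h3 := hi (hm p hp) (hm q hq) (Prod.ext (sub_left_injective h1) h2)
    have h4 := congrArg Prod.fst h3
    have h5 := congrArg Prod.snd h3
    exact Prod.ext (add_right_cancel h4) h5
  · obtain ⟨a, b, c⟩ := hφ _ (hm p hp)
    refine ⟨?_, ?_, c.trans_le hδε⟩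
    · rw [mem_sub]
      simpa using a
    · rw [dist_eq_norm] at b ⊢
      simp only at b ⊢
      rw [sub_sub, add_comm x]
      exact b.trans_le hδε

theorem entourage_mono {ε δ : ℝ} (hε : 0 < ε) (h : ε ≤ δ) :
    entourage d X ε ⊆ entourage d X δ := fun _ hz => ⟨hz.1.mono hε h, hz.2.mono hε h⟩

/-- The uniformity with basis `entourage d X ε`, `ε > 0`. -/
instance : UniformSpace (DeloneSet d X) :=
  UniformSpace.ofCore
    { uniformity := ⨅ ε : {ε : ℝ // 0 < ε}, Filter.principal (entourage d X ε)
      refl := le_iInf fun ε => by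
        rw [Filter.principal_mono]
        rintro ⟨Λ, Λ'⟩ (h : Λ = Λ')
        subst h
        exact ⟨.refl ε.2 Λ, .refl ε.2 Λ⟩
      symm := Filter.tendsto_iInf.2 fun ε => Filter.tendsto_iInf' ε <|
        Filter.tendsto_principal_principal.2 fun z hz => ⟨hz.2, hz.1⟩
      comp := le_iInf fun ε => by
        have hδ : 0 < min (ε.1 / 2) (1 / 2) := lt_min (half_pos ε.2) (by norm_num)
        have hm := Filter.mem_iInf_of_mem (f := fun ε : {ε : ℝ // 0 < ε} =>
          Filter.principal (entourage d X ε)) ⟨_, hδ⟩ (Filter.mem_principal_self _)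
        refine (Filter.lift'_le hm ?_)
        rw [Filter.principal_mono]
        rintro ⟨Λ, Λ''⟩ ⟨Λ', h, h'⟩
        have h1 : 2 * min (ε.1 / 2) (1 / 2) ≤ ε.1 := by
          linarith [min_le_left (ε.1 / 2) (1 / 2)]
        have h2 : 2 * min (ε.1 / 2) (1 / 2) ≤ 1 := by
          linarith [min_le_right (ε.1 / 2) (1 / 2)]
        exact ⟨h.1.comp hδ h1 h2 h'.1, h'.2.comp hδ h1 h2 h.2⟩ }

theorem hasBasis_uniformity :
    (uniformity (DeloneSet d X)).HasBasis (fun ε : ℝ => 0 < ε) (entourage d X) := by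
  have : (uniformity (DeloneSet d X)) =
      ⨅ ε : {ε : ℝ // 0 < ε}, Filter.principal (entourage d X ε) := rfl
  rw [this]
  have hdir : Directed (· ≥ ·) (fun ε : {ε : ℝ // 0 < ε} => entourage d X ε) := by
    intro a b
    exact ⟨⟨min a.1 b.1, lt_min a.2 b.2⟩, entourage_mono (lt_min a.2 b.2) (min_le_left _ _),
      entourage_mono (lt_min a.2 b.2) (min_le_right _ _)⟩
  have : Nonempty {ε : ℝ // 0 < ε} := ⟨⟨1, one_pos⟩⟩
  constructor
  intro t
  rw [(Filter.hasBasis_iInf_principal hdir).mem_iff]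
  simp

theorem uniformContinuous_sub (x : Euc d) :
    UniformContinuous (fun Λ : DeloneSet d X => Λ - x) := by
  rw [hasBasis_uniformity.uniformContinuous_iff hasBasis_uniformity]
  intro ε hε
  have hpos : 0 < ε⁻¹ + ‖x‖ := by positivity
  have h1 : (ε⁻¹ + ‖x‖)⁻¹ ≤ ε := by
    rw [inv_le_comm₀ hpos hε]; linarith [norm_nonneg x]
  have h2 : ε⁻¹ + ‖x‖ ≤ ((ε⁻¹ + ‖x‖)⁻¹)⁻¹ := by rw [inv_inv]
  exact ⟨(ε⁻¹ + ‖x‖)⁻¹, by positivity, fun Λ Λ' h => ⟨h.1.sub h1 x h2, h.2.sub h1 x h2⟩⟩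

end DeloneSet

/-- The hull `Ω_Λ` of `Λ`: the closure of its set of translates. -/
def Hull (Λ : DeloneSet d X) : Type _ :=
  {T : DeloneSet d X // T ∈ closure (Set.range fun x : Euc d => Λ - x)}

namespace Hull

variable {Λ : DeloneSet d X} {Λ' : DeloneSet d Y}

instance : UniformSpace (Hull Λ) := inferInstanceAs (UniformSpace (Subtype _))

instance : MeasurableSpace (Hull Λ) := borel _

instance : BorelSpace (Hull Λ) := ⟨rfl⟩

theorem sub_mem (T : Hull Λ) (x : Euc d) :
    T.1 - x ∈ closure (Set.range fun x : Euc d => Λ - x) := by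
  refine map_mem_closure (f := fun S : DeloneSet d X => S - x)
    (DeloneSet.uniformContinuous_sub x).continuous T.2 ?_
  rintro _ ⟨y, rfl⟩
  exact ⟨y + x, (DeloneSet.sub_sub_eq Λ y x).symm⟩

/-- The translation action of `ℝ^d` on the hull, written `T - x`. -/
instance : HSub (Hull Λ) (Euc d) (Hull Λ) := ⟨fun T x => ⟨T.1 - x, T.sub_mem x⟩⟩

end Hull

section Dynamics

variable (Λ : DeloneSet d X)

/-- Every orbit is dense. -/
def IsMinimal : Prop := ∀ T : Hull Λ, Dense (Set.range fun x : Euc d => T - x)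

/-- No element of the hull has a nonzero period. -/
def IsAperiodic : Prop := ∀ (T : Hull Λ) (x : Euc d), T - x = T → x = 0

variable {Λ}

/-- A translation-invariant Borel probability measure. -/
structure IsInvariantProbability (μ : Measure (Hull Λ)) : Prop where
  isProbability : IsProbabilityMeasure μ
  invariant : ∀ x : Euc d, μ.map (fun T : Hull Λ => T - x) = μ

/-- The hull is uniquely ergodic, and `μ` is its invariant probability measure. -/
def IsUniquelyErgodic (μ : Measure (Hull Λ)) : Prop :=
  IsInvariantProbability μ ∧ ∀ ν : Measure (Hull Λ), IsInvariantProbability ν → ν = μ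

/-- A homeomorphism is an orbit equivalence if it maps every orbit onto an orbit. -/
def IsOrbitEquivalence {Λ' : DeloneSet d Y} (h : Hull Λ ≃ₜ Hull Λ') : Prop :=
  ∀ T : Hull Λ, h '' (Set.range fun x : Euc d => T - x) = Set.range fun y : Euc d => h T - y

/-- Local maps: the patch of the image around the origin only depends on a patch around the
origin. -/
def IsLocalMap {Λ' : DeloneSet d Y} (φ : Hull Λ → Hull Λ') : Prop :=
  ∀ r > 0, ∃ R > 0, ∀ T T' : Hull Λ,
    T.1.patch R = T'.1.patch R → (φ T).1.patch r = (φ T').1.patch r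

/-- Strong pattern equivariance of a function on the hull. -/
def IsStronglyPE {A : Type*} (f : Hull Λ → A) : Prop :=
  ∃ R > 0, ∀ T T' : Hull Λ, T.1.patch R = T'.1.patch R → f T = f T'

theorem IsStronglyPE.const {A : Type*} (a : A) : IsStronglyPE (fun _ : Hull Λ => a) :=
  ⟨1, one_pos, fun _ _ _ => rfl⟩

theorem IsStronglyPE.comp {A B : Type*} {f : Hull Λ → A} (hf : IsStronglyPE f) (g : A → B) :
    IsStronglyPE (fun T => g (f T)) := by
  obtain ⟨R, hR, h⟩ := hf
  exact ⟨R, hR, fun T T' hT => congrArg g (h T T' hT)⟩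

theorem IsStronglyPE.comp₂ {A B C : Type*} {f : Hull Λ → A} {f' : Hull Λ → B}
    (hf : IsStronglyPE f) (hf' : IsStronglyPE f') (g : A → B → C) :
    IsStronglyPE (fun T => g (f T) (f' T)) := by
  obtain ⟨R, hR, h⟩ := hf
  obtain ⟨R', -, h'⟩ := hf'
  refine ⟨max R R', lt_max_of_lt_left hR, fun T T' hT => ?_⟩
  simp only [h T T' (DeloneSet.patch_mono (le_max_left _ _) hT),
    h' T T' (DeloneSet.patch_mono (le_max_right _ _) hT)]

end Dynamics

section Cohomology

variable (Λ : DeloneSet d X)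

/-- Weak dynamical `1`-cocycles with values in `ℝ^d`. -/
def weakCocycles : AddSubgroup C(Hull Λ × Euc d, Euc d) where
  carrier := {α | ∀ (T : Hull Λ) (x y : Euc d), α (T, x) + α (T - x, y) = α (T, x + y)}
  zero_mem' := by intro T x y; simp
  add_mem' := by
    intro α β hα hβ T x y
    simp only [ContinuousMap.add_apply, ← hα T x y, ← hβ T x y]
    abel
  neg_mem' := by
    intro α hα T x y
    simp only [ContinuousMap.neg_apply, ← hα T x y]
    abel

/-- Weak coboundaries `δs (T, v) = s (T - v) - s T`, with `s` continuous on the hull. -/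
def weakCoboundaries : AddSubgroup (weakCocycles Λ) where
  carrier := {α | ∃ s : C(Hull Λ, Euc d), ∀ (T : Hull Λ) (v : Euc d),
    α.1 (T, v) = s (T - v) - s T}
  zero_mem' := ⟨0, by intro T v; simp⟩
  add_mem' := by
    rintro α β ⟨s, hs⟩ ⟨t, ht⟩
    refine ⟨s + t, fun T v => ?_⟩
    simp only [AddSubgroup.coe_add, ContinuousMap.add_apply, hs, ht]
    abel
  neg_mem' := by
    rintro α ⟨s, hs⟩
    refine ⟨-s, fun T v => ?_⟩
    simp only [AddSubgroup.coe_neg, ContinuousMap.neg_apply, hs]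
    abel

/-- The weak cohomology group `H¹_w(Ω; ℝ^d)`. -/
abbrev WeakH1 : Type _ := weakCocycles Λ ⧸ weakCoboundaries Λ

/-- Strong dynamical `1`-cocycles: `T ↦ α (T, v)` is strongly pattern equivariant for every `v`. -/
def strongCocycles : AddSubgroup C(Hull Λ × Euc d, Euc d) where
  carrier := {α | α ∈ weakCocycles Λ ∧ ∀ v : Euc d, IsStronglyPE fun T : Hull Λ => α (T, v)}
  zero_mem' := ⟨zero_mem _, fun _ => IsStronglyPE.const 0⟩
  add_mem' := by
    rintro α β ⟨hα, hα'⟩ ⟨hβ, hβ'⟩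
    exact ⟨add_mem hα hβ, fun v => (hα' v).comp₂ (hβ' v) (· + ·)⟩
  neg_mem' := by
    rintro α ⟨hα, hα'⟩
    exact ⟨neg_mem hα, fun v => (hα' v).comp (- ·)⟩

/-- Strong coboundaries `δs`, with `s` continuous and strongly pattern equivariant. -/
def strongCoboundaries : AddSubgroup (strongCocycles Λ) where
  carrier := {α | ∃ s : C(Hull Λ, Euc d), IsStronglyPE s ∧ ∀ (T : Hull Λ) (v : Euc d),
    α.1 (T, v) = s (T - v) - s T}
  zero_mem' := ⟨0, IsStronglyPE.const 0, by intro T v; simp⟩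
  add_mem' := by
    rintro α β ⟨s, hs', hs⟩ ⟨t, ht', ht⟩
    refine ⟨s + t, hs'.comp₂ ht' (· + ·), fun T v => ?_⟩
    simp only [AddSubgroup.coe_add, ContinuousMap.add_apply, hs, ht]
    abel
  neg_mem' := by
    rintro α ⟨s, hs', hs⟩
    refine ⟨-s, hs'.comp (- ·), fun T v => ?_⟩
    simp only [AddSubgroup.coe_neg, ContinuousMap.neg_apply, hs]
    abel

/-- The strong cohomology group `H¹_s(Ω; ℝ^d)`. -/
abbrev StrongH1 : Type _ := strongCocycles Λ ⧸ strongCoboundaries Λ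

/-- Closed, weakly pattern-equivariant, `ℝ^d`-valued `1`-forms. The form on the leaf of `T` is
`x ↦ η (T - x)`; it is smooth, and its derivatives of all orders (including order `0`) are
continuous functions on the hull. -/
structure PEForm where
  toFun : Hull Λ → (Euc d →L[ℝ] Euc d)
  smooth : ∀ T : Hull Λ, ContDiff ℝ ∞ fun x : Euc d => toFun (T - x)
  equivariant : ∀ n : ℕ, Continuous fun T : Hull Λ =>
    iteratedFDeriv ℝ n (fun x : Euc d => toFun (T - x)) 0
  closed : ∀ (T : Hull Λ) (x u v : Euc d),
    fderiv ℝ (fun y : Euc d => toFun (T - y)) x u v =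
      fderiv ℝ (fun y : Euc d => toFun (T - y)) x v u

variable {Λ}

/-- `α (T, ·)` is the primitive, vanishing at `0`, of the form `η` on the leaf of `T`; hence `α` is
the dynamical cocycle corresponding to the closed form `η`. -/
def PEForm.HasPrimitive (η : PEForm Λ) (α : C(Hull Λ × Euc d, Euc d)) : Prop :=
  ∀ (T : Hull Λ) (x : Euc d), HasFDerivAt (fun v : Euc d => α (T, v)) (η.toFun (T - x)) x

/-- The form `η` represents the weak class `c`. -/
def PEForm.RepresentsWeak (η : PEForm Λ) (c : WeakH1 Λ) : Prop :=
  ∃ α : weakCocycles Λ, η.HasPrimitive α.1 ∧ (QuotientAddGroup.mk α : WeakH1 Λ) = c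

/-- The form `η` is strongly pattern equivariant and represents the strong class `c`. -/
def PEForm.RepresentsStrong (η : PEForm Λ) (c : StrongH1 Λ) : Prop :=
  IsStronglyPE η.toFun ∧
    ∃ α : strongCocycles Λ, η.HasPrimitive α.1 ∧ (QuotientAddGroup.mk α : StrongH1 Λ) = c

/-- The matrix `∫ η(T) dμ(T)` in the standard basis. -/
def PEForm.average (μ : Measure (Hull Λ)) (η : PEForm Λ) : Matrix (Fin d) (Fin d) ℝ :=
  Matrix.of fun i j => ∫ T, (η.toFun T (EuclideanSpace.single j 1)) i ∂μ

/-- `C = C_μ(c)` for a weak class `c`: the class is represented by forms, and the average of every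
representative is `C`. -/
structure IsRuelleSullivanWeak (μ : Measure (Hull Λ)) (c : WeakH1 Λ)
    (C : Matrix (Fin d) (Fin d) ℝ) : Prop where
  exists_form : ∃ η : PEForm Λ, η.RepresentsWeak c
  average_eq : ∀ η : PEForm Λ, η.RepresentsWeak c → η.average μ = C

/-- `C = C_μ(c)` for a strong class `c`, computed with strongly pattern-equivariant forms. -/
structure IsRuelleSullivanStrong (μ : Measure (Hull Λ)) (c : StrongH1 Λ)
    (C : Matrix (Fin d) (Fin d) ℝ) : Prop where
  exists_form : ∃ η : PEForm Λ, η.RepresentsStrong c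
  average_eq : ∀ η : PEForm Λ, η.RepresentsStrong c → η.average μ = C

/-- `α` is the cocycle `(T, x) ↦ g_T(x)` of `g`, defined by `g (T - x) = g T - g_T(x)`. -/
def IsCocycleOf {Λ' : DeloneSet d Y} (g : Hull Λ → Hull Λ') (α : C(Hull Λ × Euc d, Euc d)) :
    Prop :=
  ∀ (T : Hull Λ) (x : Euc d), g (T - x) = g T - α (T, x)

/-- `c` is the weak class `[h]`: the class of the cocycle of `h`. -/
def IsWeakClassOf {Λ' : DeloneSet d Y} (h : Hull Λ ≃ₜ Hull Λ') (c : WeakH1 Λ) : Prop :=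
  ∃ α : weakCocycles Λ, IsCocycleOf h α.1 ∧ (QuotientAddGroup.mk α : WeakH1 Λ) = c

/-- `c` is the strong class `[h]`: the class of the cocycle of a local map of the form
`h_s(T) = h(T) - s(T)` with `s` continuous. -/
def IsStrongClassOf {Λ' : DeloneSet d Y} (h : Hull Λ ≃ₜ Hull Λ') (c : StrongH1 Λ) : Prop :=
  ∃ s : C(Hull Λ, Euc d), IsLocalMap (fun T => h T - s T) ∧
    ∃ α : strongCocycles Λ, IsCocycleOf (fun T => h T - s T) α.1 ∧
      (QuotientAddGroup.mk α : StrongH1 Λ) = c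

end Cohomology

end Tiling

end

/-! Every continuous motion inside a totally disconnected piece of the transversal (the elements
with a point at the origin) is constant. Move `T` by `x` in a small ball, follow a point of `h T`
through `h (T - x)`, and recentre at that point. The result moves continuously in the transversal of
the second hull. It stays in a countable set if `h` preserves orbits, and the whole transversal is
totally disconnected under FLC, so it does not move. Hence `h (T - x)` is a small translate of `h T`
(`exists_forall_small_translation`). Adding up small steps and using aperiodicity gives a unique
continuous cocycle `α` (`exists_isCocycleOf`), and likewise `β` for `h.symm`. Cocycles grow at most
linearly, and `β (h T, α (T, x)) = x`, so `‖x‖ ≤ K * (‖α (T, x)‖ + 1)`.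

Convolving `α (T, ·)` with a bump function produces a cohomologous cocycle that is the primitive of
a closed form (`exists_smooth_cohomologous`). Integrating any representing form along segments shows
that its average sends `x` to `∫ α (T, x) dμ`, which depends on the class alone.

For invertibility, let `∫ α (T, x) dμ = 0`. The cocycle identity makes `α (T, n • x) / n` a Birkhoff
average, which converges in `L²` by the mean ergodic theorem. The limit is invariant under all
translations and has mean zero, so it vanishes by unique ergodicity. The linear lower bound on `α`
then forces `x = 0`.

Under FLC, a continuous choice of a point of `h T`, made on the transversal and averaged over the
points of `T` near the origin, gives `s` with `h - s` local (`exists_isLocalMap`). In an aperiodic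
hull bounded translations can be read off from patches (`exists_translation_determined`). This makes
the cocycle of a local map pattern equivariant, and the difference of two choices of `s` as well, so
the strong class exists and is unique. Its cocycle is `α + δs`, with the same average. -/

noncomputable section

namespace Tiling

variable {d : ℕ} {X Y : Type*} [MetricSpace X] [MetricSpace Y]

/-! ### Separation, covering and compactness for sets of Delone sets. -/

namespace DeloneSet

open Filter

theorem mem_uniformity_near (R : ℝ) {ε : ℝ} (hε : 0 < ε) :
    {z : DeloneSet d X × DeloneSet d X |
      ∀ p ∈ z.1.patch R, ∃ q ∈ z.2.carrier, dist q p < ε} ∈ uniformity (DeloneSet d X) := by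
  -- The inverse of this number is at least `|R| + 1`, so the matched ball contains the patch of
  -- radius `R` whatever the sign of `R`.
  have hδ : 0 < min ε (|R| + 1)⁻¹ := lt_min hε (by positivity)
  refine hasBasis_uniformity.mem_iff.2 ⟨_, hδ, fun z hz p hp => ?_⟩
  obtain ⟨φ, -, hφ⟩ := hz.1
  have hR : R ≤ (min ε (|R| + 1)⁻¹)⁻¹ := by
    have := inv_anti₀ hδ (min_le_right ε (|R| + 1)⁻¹)
    rw [inv_inv] at this
    linarith [le_abs_self R]
  obtain ⟨h1, h2, h3⟩ := hφ p ⟨hp.1, hp.2.trans_le hR⟩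
  exact ⟨φ p, h1, max_lt (h2.trans_le (min_le_left _ _)) (h3.trans_le (min_le_left _ _))⟩

theorem mem_uniformity_near' (R : ℝ) {ε : ℝ} (hε : 0 < ε) :
    {z : DeloneSet d X × DeloneSet d X |
      ∀ p ∈ z.2.patch R, ∃ q ∈ z.1.carrier, dist q p < ε} ∈ uniformity (DeloneSet d X) :=
  UniformSpace.symm (mem_uniformity_near R hε)

theorem eventually_near (T : DeloneSet d X) {p : Euc d × X} (hp : p ∈ T.carrier) {ε : ℝ}
    (hε : 0 < ε) : ∀ᶠ S in 𝓝 T, ∃ q ∈ S.carrier, dist q p < ε := by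
  have := mem_nhds_left T (mem_uniformity_near (d := d) (X := X) (‖p.1‖ + 1) hε)
  filter_upwards [this] with S hS
  exact hS p ⟨hp, by linarith⟩

/-- Distinct elements of the graph lie over points at distance at least `r`. -/
def IsSeparatedBy (r : ℝ) (S : DeloneSet d X) : Prop :=
  ∀ p ∈ S.carrier, ∀ q ∈ S.carrier, p ≠ q → r ≤ dist p.1 q.1

/-- Every closed ball of radius `R` contains a point. -/
def IsCoveringBy (R : ℝ) (S : DeloneSet d X) : Prop :=
  ∀ x : Euc d, ∃ p ∈ S.carrier, dist p.1 x ≤ R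

theorem IsSeparatedBy.eq {r : ℝ} {S : DeloneSet d X} (h : S.IsSeparatedBy r) {p q : Euc d × X}
    (hp : p ∈ S.carrier) (hq : q ∈ S.carrier) (hpq : dist p.1 q.1 < r) : p = q := by
  by_contra hne
  exact absurd (h p hp q hq hne) (not_le.2 hpq)

theorem IsSeparatedBy.sub {r : ℝ} {S : DeloneSet d X} (h : S.IsSeparatedBy r) (x : Euc d) :
    (S - x).IsSeparatedBy r := by
  intro p hp q hq hpq
  have := h _ hp _ hq (fun he => hpq (by
    have h1 := congrArg Prod.fst he
    have h2 := congrArg Prod.snd he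
    exact Prod.ext (add_right_cancel h1) h2))
  simpa using this

theorem IsCoveringBy.sub {R : ℝ} {S : DeloneSet d X} (h : S.IsCoveringBy R) (x : Euc d) :
    (S - x).IsCoveringBy R := by
  intro y
  obtain ⟨p, hp, hd⟩ := h (y + x)
  refine ⟨(p.1 - x, p.2), by simpa [mem_sub] using hp, ?_⟩
  rw [dist_eq_norm] at hd ⊢
  simpa [sub_sub, add_comm] using hd

/-- A ball is covered by finitely many balls of radius `r / 2`, each of which lies under at most one
element of the graph. -/
theorem finite_patch (S : DeloneSet d X) (R : ℝ) : (S.patch R).Finite := by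
  obtain ⟨r, hr, h⟩ := S.uniformlyDiscrete
  obtain ⟨t, ht, hcov⟩ := Metric.totallyBounded_iff.1
    (isCompact_closedBall (0 : Euc d) R).totallyBounded (r / 2) (half_pos hr)
  refine (ht.biUnion (t := fun y => {p ∈ S.carrier | dist p.1 y < r / 2})
    fun y _ => Set.Subsingleton.finite ?_).subset fun p hp => ?_
  · intro p hp q hq
    by_contra hne
    have h1 := h p hp.1 q hq.1 hne
    have h2 := dist_triangle_right p.1 q.1 y
    linarith [hp.2, hq.2]
  · have := hcov (show p.1 ∈ Metric.closedBall 0 R by simpa using hp.2.le)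
    simp only [Set.mem_iUnion, Metric.mem_ball] at this
    obtain ⟨y, hy, hpy⟩ := this
    exact Set.mem_biUnion hy ⟨hp.1, hpy⟩

theorem countable_carrier (S : DeloneSet d X) : S.carrier.Countable := by
  refine (Set.countable_iUnion fun n : ℕ => (S.finite_patch n).countable).mono fun p hp => ?_
  obtain ⟨n, hn⟩ := exists_nat_gt ‖p.1‖
  exact Set.mem_iUnion.2 ⟨n, hp, hn⟩

/-- Approximants at two scales coincide by separation, so a positive distance to `p` would be
smaller than itself. -/
theorem mem_carrier_of_forall_near {S : DeloneSet d X} {p : Euc d × X}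
    (h : ∀ ε > 0, ∃ q ∈ S.carrier, dist q p < ε) : p ∈ S.carrier := by
  obtain ⟨r, hr, hS⟩ := S.uniformlyDiscrete
  obtain ⟨q, hq, hqp⟩ := h (r / 2) (half_pos hr)
  by_contra hp
  have hne : q ≠ p := fun h => hp (h ▸ hq)
  obtain ⟨q', hq', hqp'⟩ := h (min (r / 2) (dist q p)) (lt_min (half_pos hr) (dist_pos.2 hne))
  have h1 : dist q.1 p.1 ≤ dist q p := le_max_left _ _
  have h2 : dist q'.1 p.1 ≤ dist q' p := le_max_left _ _
  have : q = q' := IsSeparatedBy.eq hS hq hq' (by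
    have := dist_triangle_right q.1 q'.1 p.1
    linarith [min_le_left (r / 2) (dist q p)])
  subst this
  exact absurd hqp' (not_lt.2 (min_le_right _ _))

instance : T0Space (DeloneSet d X) := by
  refine t0Space_iff_uniformity.2 fun S T h => ?_
  have key : ∀ S T : DeloneSet d X, (∀ r ∈ uniformity (DeloneSet d X), (S, T) ∈ r) →
      S.carrier ⊆ T.carrier := by
    intro S T h p hp
    refine mem_carrier_of_forall_near fun ε hε => ?_
    exact h _ (mem_uniformity_near (‖p.1‖ + 1) hε) p ⟨hp, by simp⟩
  refine DeloneSet.ext (Set.Subset.antisymm (key S T h) (key T S fun r hr => ?_))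
  exact h _ (UniformSpace.symm hr)

instance : IsCountablyGenerated (uniformity (DeloneSet d X)) := by
  have : (uniformity (DeloneSet d X)).HasBasis (fun _ : ℕ => True)
      (fun n => entourage d X ((n : ℝ) + 1)⁻¹) := by
    refine hasBasis_uniformity.to_hasBasis (fun ε hε => ?_) fun n _ => ⟨_, by positivity, le_rfl⟩
    obtain ⟨n, hn⟩ := exists_nat_gt ε⁻¹
    refine ⟨n, trivial, entourage_mono (by positivity) ?_⟩
    rw [inv_le_comm₀ (by positivity) hε]
    linarith
  exact this.isCountablyGenerated

theorem isClosed_isSeparatedBy (r : ℝ) : IsClosed {S : DeloneSet d X | S.IsSeparatedBy r} := by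
  refine isClosed_of_closure_subset fun T hT p hp q hq hpq => ?_
  refine le_of_forall_pos_le_add fun ε hε => ?_
  have hd : 0 < dist p q := dist_pos.2 hpq
  -- The second entry uses the product metric, so the approximants stay distinct even when `p` and
  -- `q` differ only in their labels.
  have hm : 0 < min (ε / 2) (dist p q / 2) := by positivity
  obtain ⟨S, hS, ⟨p', hp', hpp'⟩, q', hq', hqq'⟩ := ((mem_closure_iff_frequently.1 hT).and_eventually
    ((eventually_near T hp hm).and (eventually_near T hq hm))).exists
  have hne : p' ≠ q' := by
    rintro rfl
    have := dist_triangle_left p q p'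
    linarith [min_le_right (ε / 2) (dist p q / 2)]
  have h1 := hS p' hp' q' hq' hne
  have h2 : dist p'.1 p.1 ≤ dist p' p := le_max_left _ _
  have h3 : dist q'.1 q.1 ≤ dist q' q := le_max_left _ _
  have h4 := dist_triangle4 p'.1 p.1 q.1 q'.1
  rw [dist_comm q.1] at h4
  linarith [min_le_left (ε / 2) (dist p q / 2)]

/-- Patches are finite, so an uncovered closed ball leaves a gap of positive width, and a nearby
covering set would have to put a point into it. -/
theorem isClosed_isCoveringBy (R : ℝ) : IsClosed {S : DeloneSet d X | S.IsCoveringBy R} := by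
  refine isClosed_of_closure_subset fun T hT x => ?_
  by_contra! hcon
  obtain ⟨ε, hε, hgap⟩ : ∃ ε > 0, ∀ p ∈ T.patch (R + ‖x‖ + 1), R + ε ≤ dist p.1 x := by
    have := (T.finite_patch (R + ‖x‖ + 1))
    rcases (T.patch (R + ‖x‖ + 1)).eq_empty_or_nonempty with h | h
    · exact ⟨1, one_pos, by simp [h]⟩
    · obtain ⟨p, hp, hmin⟩ := this.exists_minimalFor (fun p => dist p.1 x) _ h
      refine ⟨dist p.1 x - R, by linarith [hcon p hp.1], fun q hq => ?_⟩
      have := hmin hq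
      rcases le_total (dist p.1 x) (dist q.1 x) with h' | h'
      · linarith
      · linarith [this h']
  have hU := mem_nhds_left T
    (mem_uniformity_near' (d := d) (X := X) (R + ‖x‖ + 1) (lt_min hε (one_pos (α := ℝ))))
  obtain ⟨S, hS, hST⟩ := ((mem_closure_iff_frequently.1 hT).and_eventually hU).exists
  obtain ⟨p, hp, hpx⟩ := hS x
  have hpn : ‖p.1‖ ≤ R + ‖x‖ := by
    have := norm_le_norm_add_norm_sub' p.1 x
    rw [dist_eq_norm] at hpx
    linarith
  obtain ⟨q, hq, hqp⟩ := hST p ⟨hp, by linarith⟩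
  have h1 : dist q.1 p.1 < min ε 1 := lt_of_le_of_lt (le_max_left _ _) hqp
  have h2 := dist_triangle q.1 p.1 x
  by_cases hqn : ‖q.1‖ < R + ‖x‖ + 1
  · have := hgap q ⟨hq, hqn⟩
    linarith [min_le_left ε 1]
  · have h3 := norm_le_norm_add_norm_sub' q.1 p.1
    rw [← dist_eq_norm] at h3
    linarith [min_le_right ε 1]

/-- The limit of an ultrafilter on the Delone sets with given constants. -/
def ultraLim {r R : ℝ} (hr : 0 < r) (F : Ultrafilter (DeloneSet d X)) [CompactSpace X]
    (hF : ∀ᶠ S in (F : Filter (DeloneSet d X)), S.IsSeparatedBy r ∧ S.IsCoveringBy R) :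
    DeloneSet d X where
  carrier := {p | ∀ ε > 0, ∀ᶠ S in (F : Filter (DeloneSet d X)), ∃ q ∈ S.carrier, dist q p < ε}
  uniformlyDiscrete := by
    refine ⟨r, hr, fun p hp q hq hpq => ?_⟩
    refine le_of_forall_pos_le_add fun ε hε => ?_
    have hd : 0 < dist p q := dist_pos.2 hpq
    have hm : 0 < min (ε / 2) (dist p q / 2) := by positivity
    obtain ⟨S, hS, ⟨p', hp', hpp'⟩, q', hq', hqq'⟩ := (hF.and ((hp _ hm).and (hq _ hm))).exists
    have hne : p' ≠ q' := by
      rintro rfl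
      have := dist_triangle_left p q p'
      linarith [min_le_right (ε / 2) (dist p q / 2)]
    have h1 := hS.1 p' hp' q' hq' hne
    have h2 : dist p'.1 p.1 ≤ dist p' p := le_max_left _ _
    have h3 : dist q'.1 q.1 ≤ dist q' q := le_max_left _ _
    have h4 := dist_triangle4 p'.1 p.1 q.1 q'.1
    rw [dist_comm q.1] at h4
    linarith [min_le_left (ε / 2) (dist p q / 2)]
  relativelyDense := by
    -- A limit of points of the sets `S` in the closed ball around `x` lies in the limit set. The
    -- radius is enlarged to be positive and to give a strict inequality.
    refine ⟨|R| + 1, by positivity, fun x => ?_⟩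
    have : ∃ f : DeloneSet d X → Euc d × X, ∀ᶠ S in (F : Filter (DeloneSet d X)),
        f S ∈ S.carrier ∧ dist (f S).1 x ≤ R := by
      have hne : Nonempty (Euc d × X) := by
        obtain ⟨S, hS⟩ := hF.exists
        obtain ⟨p, -⟩ := hS.2 x
        exact ⟨p⟩
      have hc : ∀ S : DeloneSet d X, ∃ p : Euc d × X,
          S.IsCoveringBy R → p ∈ S.carrier ∧ dist p.1 x ≤ R := fun S => by
        by_cases hS : S.IsCoveringBy R
        · obtain ⟨p, hp⟩ := hS x
          exact ⟨p, fun _ => hp⟩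
        · exact ⟨hne.some, fun h => absurd h hS⟩
      choose f hf using hc
      exact ⟨f, hF.mono fun S hS => hf S hS.2⟩
    obtain ⟨f, hf⟩ := this
    have hK : IsCompact (Metric.closedBall x R ×ˢ (Set.univ : Set X)) :=
      (isCompact_closedBall x R).prod isCompact_univ
    obtain ⟨p, hp, hlim⟩ := hK.ultrafilter_le_nhds (F.map f) (by
      rw [le_principal_iff]
      exact hf.mono fun S hS => ⟨hS.2, trivial⟩)
    refine ⟨p, fun ε hε => ?_, ?_⟩
    · have : ∀ᶠ S in (F : Filter (DeloneSet d X)), dist (f S) p < ε :=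
        hlim (Metric.ball_mem_nhds p hε)
      exact (this.and hf).mono fun S hS => ⟨f S, hS.2.1, hS.1⟩
    · have := hp.1
      rw [Metric.mem_closedBall] at this
      linarith [le_abs_self R]

/-- Matching the limit into `S` involves finitely many elements. Conversely, elements of `S` that
stay away from the limit set would converge along the ultrafilter, by compactness, to an element of
it. -/
theorem le_nhds_ultraLim {r R : ℝ} (hr : 0 < r) (F : Ultrafilter (DeloneSet d X)) [CompactSpace X]
    (hF : ∀ᶠ S in (F : Filter (DeloneSet d X)), S.IsSeparatedBy r ∧ S.IsCoveringBy R) :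
    (F : Filter (DeloneSet d X)) ≤ 𝓝 (ultraLim hr F hF) := by
  set T := ultraLim hr F hF with hTdef
  obtain ⟨r', hr', hT'⟩ := T.uniformlyDiscrete
  rw [(nhds_basis_uniformity' hasBasis_uniformity).ge_iff]
  intro ε hε
  -- The bound `ρ / 2` makes any choice of nearby elements injective.
  have hmatch : ∀ (S S' : DeloneSet d X) (ρ : ℝ), S.IsSeparatedBy ρ →
      (∀ p ∈ S.patch ε⁻¹, ∃ q ∈ S'.carrier, dist q p < min ε (ρ / 2)) → MatchesInto ε S S' := by
    intro S S' ρ hS h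
    choose! φ hφ using h
    refine ⟨φ, fun p hp q hq hpq => ?_, fun p hp => ⟨(hφ p hp).1, ?_, ?_⟩⟩
    · refine hS.eq hp.1 hq.1 ?_
      have h1 : dist (φ p).1 p.1 ≤ dist (φ p) p := le_max_left _ _
      have h2 : dist (φ q).1 q.1 ≤ dist (φ q) q := le_max_left _ _
      have h3 := dist_triangle_left p.1 q.1 (φ p).1
      have h4 := (hφ p hp).2
      have h5 := (hφ q hq).2
      rw [← hpq] at h2 h5
      linarith [min_le_right ε (ρ / 2)]
    · exact (le_max_left _ _).trans_lt ((hφ p hp).2.trans_le (min_le_left _ _))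
    · exact (le_max_right _ _).trans_lt ((hφ p hp).2.trans_le (min_le_left _ _))
  have h1 : ∀ᶠ S in (F : Filter (DeloneSet d X)),
      ∀ p ∈ T.patch ε⁻¹, ∃ q ∈ S.carrier, dist q p < min ε (r' / 2) :=
    (T.finite_patch ε⁻¹).eventually_all.2 fun p hp => hp.1 _ (by positivity)
  have h2 : ∀ᶠ S in (F : Filter (DeloneSet d X)),
      ∀ p ∈ S.patch ε⁻¹, ∃ q ∈ T.carrier, dist q p < min ε (r / 2) := by
    by_contra hcon
    rw [Ultrafilter.eventually_not.symm] at hcon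
    have hne : Nonempty (Euc d × X) := by
      obtain ⟨S, hS⟩ := hcon.exists
      push Not at hS
      exact ⟨hS.choose⟩
    have hc : ∀ S : DeloneSet d X, ∃ p : Euc d × X,
        (¬∀ p ∈ S.patch ε⁻¹, ∃ q ∈ T.carrier, dist q p < min ε (r / 2)) →
          p ∈ S.patch ε⁻¹ ∧ ∀ q ∈ T.carrier, min ε (r / 2) ≤ dist q p := by
      intro S
      by_cases hS : ∀ p ∈ S.patch ε⁻¹, ∃ q ∈ T.carrier, dist q p < min ε (r / 2)
      · exact ⟨hne.some, fun h => absurd hS h⟩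
      · push Not at hS
        obtain ⟨p, hp⟩ := hS
        exact ⟨p, fun _ => hp⟩
    choose f hf using hc
    have hf' := hcon.mono fun S hS => hf S hS
    have hK : IsCompact (Metric.closedBall (0 : Euc d) ε⁻¹ ×ˢ (Set.univ : Set X)) :=
      (isCompact_closedBall _ _).prod isCompact_univ
    obtain ⟨p, hp, hlim⟩ := hK.ultrafilter_le_nhds (F.map f) (by
      rw [le_principal_iff]
      refine hf'.mono fun S hS => ⟨?_, trivial⟩
      simpa using hS.1.2.le)
    have hball : ∀ δ > 0, ∀ᶠ S in (F : Filter (DeloneSet d X)), dist (f S) p < δ :=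
      fun δ hδ => hlim (Metric.ball_mem_nhds p hδ)
    have hpT : p ∈ T.carrier := fun δ hδ =>
      ((hball δ hδ).and hf').mono fun S hS => ⟨f S, hS.2.1.1, hS.1⟩
    obtain ⟨S, hS1, hS2⟩ := ((hball (min ε (r / 2)) (by positivity)).and hf').exists
    have := hS2.2 p hpT
    rw [dist_comm] at this
    linarith
  filter_upwards [h1, h2, hF] with S hS1 hS2 hS
  exact ⟨hmatch T S r' hT' hS1, hmatch S T r hS.1 hS2⟩

theorem isCompact_isSeparatedBy_isCoveringBy [CompactSpace X] {r : ℝ} (hr : 0 < r) (R : ℝ) :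
    IsCompact {S : DeloneSet d X | S.IsSeparatedBy r ∧ S.IsCoveringBy R} := by
  refine isCompact_iff_ultrafilter_le_nhds.2 fun F hF => ?_
  rw [le_principal_iff] at hF
  have hlim := le_nhds_ultraLim hr F hF
  exact ⟨_, ((isClosed_isSeparatedBy r).inter (isClosed_isCoveringBy R)).mem_of_tendsto
    (f := id) (b := F) hlim hF, hlim⟩

theorem entourage_of_patch_eq {ε : ℝ} (hε : 0 < ε) {S T : DeloneSet d X}
    (h : S.patch ε⁻¹ = T.patch ε⁻¹) : (S, T) ∈ entourage d X ε := by
  have key : ∀ S T : DeloneSet d X, S.patch ε⁻¹ = T.patch ε⁻¹ → MatchesInto ε S T :=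
    fun S T h => ⟨id, Set.injOn_id _, fun p hp => ⟨(h ▸ hp : p ∈ T.patch ε⁻¹).1, by simpa, by simpa⟩⟩
  exact ⟨key S T h, key T S h.symm⟩

theorem sub_zero (S : DeloneSet d X) : S - (0 : Euc d) = S := by
  ext p
  simp [mem_sub]

theorem entourage_sub {ε : ℝ} {x y : Euc d} (h : ‖x - y‖ < ε) (S : DeloneSet d X) :
    (S - x, S - y) ∈ entourage d X ε := by
  have hε : 0 < ε := (norm_nonneg _).trans_lt h
  have key : ∀ x y : Euc d, ‖x - y‖ < ε → MatchesInto ε (S - x) (S - y) := by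
    intro x y h
    refine ⟨fun p => (p.1 + (x - y), p.2), fun p _ q _ hpq => ?_, fun p hp => ⟨?_, ?_, by simpa⟩⟩
    · have h1 := congrArg Prod.fst hpq
      have h2 := congrArg Prod.snd hpq
      exact Prod.ext (add_right_cancel h1) h2
    · have := hp.1
      rw [mem_sub] at this ⊢
      simpa [add_assoc] using this
    · simpa [dist_eq_norm] using h
  exact ⟨key x y h, key y x (by rwa [norm_sub_rev])⟩

end DeloneSet

/-! ### Compactness of the hull and continuity of the action. -/

namespace Hull

open Filter

variable {Λ : DeloneSet d X}

@[ext]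
theorem ext {S T : Hull Λ} (h : S.1 = T.1) : S = T := Subtype.ext h

theorem val_sub (T : Hull Λ) (x : Euc d) : (T - x).1 = T.1 - x := rfl

theorem sub_sub_eq (T : Hull Λ) (x y : Euc d) : T - x - y = T - (x + y) :=
  ext (DeloneSet.sub_sub_eq T.1 x y)

theorem sub_zero (T : Hull Λ) : T - (0 : Euc d) = T := ext (DeloneSet.sub_zero T.1)

instance : Nonempty (Hull Λ) := ⟨⟨Λ, subset_closure ⟨0, DeloneSet.sub_zero Λ⟩⟩⟩

instance : T0Space (Hull Λ) := inferInstanceAs (T0Space (Subtype _))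

theorem uniformity_eq : uniformity (Hull Λ) =
    comap (fun z : Hull Λ × Hull Λ => (z.1.1, z.2.1)) (uniformity (DeloneSet d X)) := rfl

theorem hasBasis_uniformity : (uniformity (Hull Λ)).HasBasis (fun ε : ℝ => 0 < ε)
    (fun ε => {z : Hull Λ × Hull Λ | (z.1.1, z.2.1) ∈ DeloneSet.entourage d X ε}) :=
  DeloneSet.hasBasis_uniformity.comap _

instance : IsCountablyGenerated (uniformity (Hull Λ)) := by
  rw [uniformity_eq]; infer_instance

theorem exists_isSeparatedBy (Λ : DeloneSet d X) :
    ∃ r > 0, ∀ T : Hull Λ, T.1.IsSeparatedBy r := by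
  obtain ⟨r, hr, h⟩ := Λ.uniformlyDiscrete
  refine ⟨r, hr, fun T => closure_minimal ?_ (DeloneSet.isClosed_isSeparatedBy r) T.2⟩
  rintro _ ⟨x, rfl⟩
  exact DeloneSet.IsSeparatedBy.sub h x

theorem exists_isCoveringBy (Λ : DeloneSet d X) :
    ∃ R > 0, ∀ T : Hull Λ, T.1.IsCoveringBy R := by
  obtain ⟨R, hR, h⟩ := Λ.relativelyDense
  have h' : Λ.IsCoveringBy R := fun x => by
    obtain ⟨p, hp, hpx⟩ := h x
    exact ⟨p, hp, hpx.le⟩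
  refine ⟨R, hR, fun T => closure_minimal ?_ (DeloneSet.isClosed_isCoveringBy R) T.2⟩
  rintro _ ⟨x, rfl⟩
  exact h'.sub x

instance [CompactSpace X] : CompactSpace (Hull Λ) := by
  obtain ⟨r, hr, h⟩ := exists_isSeparatedBy Λ
  obtain ⟨R, -, h'⟩ := exists_isCoveringBy Λ
  have : IsCompact (closure (Set.range fun x : Euc d => Λ - x)) :=
    (DeloneSet.isCompact_isSeparatedBy_isCoveringBy hr R).of_isClosed_subset isClosed_closure
      fun T hT => ⟨h ⟨T, hT⟩, h' ⟨T, hT⟩⟩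
  exact isCompact_iff_compactSpace.1 this

theorem exists_forall_sub_mem {V : Set (Hull Λ × Hull Λ)} (hV : V ∈ uniformity (Hull Λ)) :
    ∃ δ > 0, ∀ (T : Hull Λ) (x y : Euc d), ‖x - y‖ < δ → (T - x, T - y) ∈ V := by
  obtain ⟨ε, hε, h⟩ := hasBasis_uniformity.mem_iff.1 hV
  exact ⟨ε, hε, fun T x y hxy => h (DeloneSet.entourage_sub hxy T.1)⟩

theorem exists_forall_patch_eq_mem {V : Set (Hull Λ × Hull Λ)} (hV : V ∈ uniformity (Hull Λ)) :
    ∃ R > 0, ∀ S T : Hull Λ, S.1.patch R = T.1.patch R → (S, T) ∈ V := by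
  obtain ⟨ε, hε, h⟩ := hasBasis_uniformity.mem_iff.1 hV
  exact ⟨ε⁻¹, by positivity, fun S T hST => h (DeloneSet.entourage_of_patch_eq hε hST)⟩

theorem mem_uniformity_near (R : ℝ) {ε : ℝ} (hε : 0 < ε) :
    {z : Hull Λ × Hull Λ | ∀ p ∈ z.1.1.patch R, ∃ q ∈ z.2.1.carrier, dist q p < ε} ∈
      uniformity (Hull Λ) := by
  rw [uniformity_eq]
  exact preimage_mem_comap (DeloneSet.mem_uniformity_near R hε)

theorem continuous_sub : Continuous fun z : Hull Λ × Euc d => z.1 - z.2 := by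
  refine continuous_iff_continuousAt.2 fun ⟨T, x⟩ => ?_
  refine Uniform.tendsto_nhds_right.2 fun V hV => ?_
  obtain ⟨W, hW, hWV⟩ := comp_mem_uniformity_sets hV
  obtain ⟨δ, hδ, h⟩ := exists_forall_sub_mem hW
  have hx : Continuous fun S : Hull Λ => S - x :=
    ((DeloneSet.uniformContinuous_sub x).continuous.comp continuous_subtype_val).subtype_mk _
  have h1 : ∀ᶠ S : Hull Λ in 𝓝 T, (T - x, S - x) ∈ W := hx.continuousAt (mem_nhds_left _ hW)
  have h2 : ∀ᶠ y in 𝓝 x, dist y x < δ := Metric.ball_mem_nhds x hδ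
  rw [nhds_prod_eq, mem_map]
  filter_upwards [h1.prod_mk h2] with z hz
  refine hWV ⟨z.1 - x, hz.1, h _ _ _ ?_⟩
  rw [← dist_eq_norm, dist_comm]
  exact hz.2

theorem _root_.Continuous.hullSub {Z : Type*} [TopologicalSpace Z] {f : Z → Hull Λ} {g : Z → Euc d}
    (hf : Continuous f) (hg : Continuous g) : Continuous fun z => f z - g z :=
  continuous_sub.comp (hf.prodMk hg)

theorem _root_.ContinuousOn.hullSub {Z : Type*} [TopologicalSpace Z] {f : Z → Hull Λ}
    {g : Z → Euc d} {s : Set Z} (hf : ContinuousOn f s) (hg : ContinuousOn g s) :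
    ContinuousOn (fun z => f z - g z) s :=
  continuous_sub.comp_continuousOn (hf.prodMk hg)

end Hull

/-! ### Nearby points, transversals and rigidity of small translations. -/

namespace DeloneSet

/-- The underlying point set, without labels. -/
def points (S : DeloneSet d X) : Set (Euc d) := Prod.fst '' S.carrier

theorem mem_points_sub {S : DeloneSet d X} {x y : Euc d} :
    y ∈ (S - x).points ↔ y + x ∈ S.points := by
  constructor
  · rintro ⟨p, hp, rfl⟩
    exact ⟨_, hp, rfl⟩
  · rintro ⟨⟨q, l⟩, hp, rfl : q = y + x⟩
    exact ⟨(y, l), hp, rfl⟩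

theorem countable_points (S : DeloneSet d X) : S.points.Countable := S.countable_carrier.image _

open Classical in
/-- A point of `S` at distance less than `η` from `p`, if there is one. -/
def nearPoint (η : ℝ) (p : Euc d) (S : DeloneSet d X) : Euc d :=
  if h : ∃ q ∈ S.points, dist q p < η then h.choose else 0

theorem nearPoint_spec {η : ℝ} {p : Euc d} {S : DeloneSet d X}
    (h : ∃ q ∈ S.points, dist q p < η) :
    nearPoint η p S ∈ S.points ∧ dist (nearPoint η p S) p < η := by
  rw [nearPoint, dif_pos h]
  exact h.choose_spec

theorem IsSeparatedBy.points_eq {r : ℝ} {S : DeloneSet d X} (h : S.IsSeparatedBy r) {p q : Euc d}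
    (hp : p ∈ S.points) (hq : q ∈ S.points) (hpq : dist p q < r) : p = q := by
  obtain ⟨p, hp, rfl⟩ := hp
  obtain ⟨q, hq, rfl⟩ := hq
  rw [h.eq hp hq hpq]

/-- Below half the separation there is only one candidate, so the arbitrary choice in `nearPoint` is
canonical and follows the set continuously. -/
theorem IsSeparatedBy.nearPoint_eq {r η : ℝ} {S : DeloneSet d X} (h : S.IsSeparatedBy r)
    (hη : 2 * η ≤ r) {p q : Euc d} (hq : q ∈ S.points) (hqp : dist q p < η) :
    nearPoint η p S = q := by
  have := nearPoint_spec ⟨q, hq, hqp⟩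
  refine h.points_eq this.1 hq ?_
  have := dist_triangle_right (nearPoint η p S) q p
  linarith

end DeloneSet

namespace Hull

open Filter

variable {Λ : DeloneSet d X} {Λ' : DeloneSet d Y}

theorem eventually_near_points (T : Hull Λ) {p : Euc d} (hp : p ∈ T.1.points) {ε : ℝ}
    (hε : 0 < ε) : ∀ᶠ S : Hull Λ in 𝓝 T, ∃ q ∈ S.1.points, dist q p < ε := by
  obtain ⟨p, hp, rfl⟩ := hp
  have := mem_nhds_left T (mem_uniformity_near (Λ := Λ) (‖p.1‖ + 1) hε)
  filter_upwards [this] with S hS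
  obtain ⟨q, hq, hqp⟩ := hS p ⟨hp, by linarith⟩
  exact ⟨q.1, ⟨q, hq, rfl⟩, (le_max_left _ _).trans_lt hqp⟩

theorem isOpen_exists_near (η : ℝ) (p : Euc d) :
    IsOpen {S : Hull Λ | ∃ q ∈ S.1.points, dist q p < η} := by
  refine isOpen_iff_mem_nhds.2 ?_
  rintro T ⟨q, hq, hqp⟩
  filter_upwards [eventually_near_points T hq (sub_pos.2 hqp)] with S hS
  obtain ⟨q', hq', hqq'⟩ := hS
  refine ⟨q', hq', ?_⟩
  have := dist_triangle q' q p
  linarith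

theorem continuousOn_nearPoint {r η : ℝ} (hr : ∀ T : Hull Λ, T.1.IsSeparatedBy r)
    (hη : 2 * η ≤ r) (p : Euc d) :
    ContinuousOn (fun S : Hull Λ => S.1.nearPoint η p)
      {S : Hull Λ | ∃ q ∈ S.1.points, dist q p < η} := by
  refine fun T hT => ContinuousAt.continuousWithinAt ?_
  obtain ⟨q, hq, hqp⟩ := hT
  refine Metric.tendsto_nhds.2 fun ε hε => ?_
  filter_upwards [eventually_near_points T hq (lt_min hε (sub_pos.2 hqp))] with S hS
  obtain ⟨q', hq', hqq'⟩ := hS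
  have h1 := dist_triangle q' q p
  rw [(hr T).nearPoint_eq hη hq hqp, (hr S).nearPoint_eq hη hq'
    (by linarith [min_le_right ε (η - dist q p)])]
  exact hqq'.trans_le (min_le_left _ _)

/-- The elements of the hull that have a point at the origin. -/
def transversal (Λ : DeloneSet d X) : Set (Hull Λ) := {T | 0 ∈ T.1.points}

theorem sub_mem_transversal {T : Hull Λ} {x : Euc d} : T - x ∈ transversal Λ ↔ x ∈ T.1.points := by
  rw [transversal, Set.mem_ofPred_eq, val_sub, DeloneSet.mem_points_sub, zero_add]

theorem isClosed_transversal : IsClosed (transversal Λ) := by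
  refine isClosed_of_closure_subset fun T hT => ?_
  have key : ∀ ε > 0, ∃ q ∈ T.1.patch 1, dist q.1 0 < ε := by
    intro ε hε
    have h1 : 0 < min ε (1 / 2) := by positivity
    have hU := mem_nhds_right T (mem_uniformity_near (Λ := Λ) 1 h1)
    obtain ⟨S, ⟨p, hp, hp0⟩, hS⟩ := ((mem_closure_iff_frequently.1 hT).and_eventually hU).exists
    obtain ⟨q, hq, hqp⟩ := hS p ⟨hp, by simp [hp0]⟩
    have h2 : dist q.1 p.1 ≤ dist q p := le_max_left _ _
    rw [hp0] at h2
    refine ⟨q, ⟨hq, ?_⟩, by linarith [min_le_left ε (1 / 2)]⟩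
    rw [← dist_zero_right]
    linarith [min_le_right ε (1 / 2)]
  have hfin := ((T.1.finite_patch 1).image Prod.fst).isClosed
  have : (0 : Euc d) ∈ Prod.fst '' T.1.patch 1 := by
    rw [← hfin.closure_eq]
    refine Metric.mem_closure_iff.2 fun ε hε => ?_
    obtain ⟨q, hq, h⟩ := key ε hε
    exact ⟨q.1, ⟨q, hq, rfl⟩, by rwa [dist_comm]⟩
  obtain ⟨p, hp, hp0⟩ := this
  exact ⟨p, hp.1, hp0⟩

/-- A point at the origin removes the translation ambiguity in FLC: such a patch is `P - q` with `q`
one of the points of `P`. Translates of `Λ` are dense and a finite set is closed, so the bound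
passes to the whole hull. -/
theorem finite_iUnion_patch_of_isFLC (hΛ : Λ.IsFLC) (R : ℝ) :
    {p : Euc d × X | ∃ T ∈ transversal Λ, p ∈ T.1.patch R}.Finite := by
  obtain ⟨S, hS, hSP⟩ := hΛ R
  -- The family `S` may contain irrelevant infinite sets, which are discarded.
  let Q : Set (Euc d × X) := ⋃ P ∈ {P ∈ S | P.Finite},
    Set.image2 (fun p q => (p.1 - q.1, p.2)) P P
  have hQ : Q.Finite := (hS.subset (Set.sep_subset _ _)).biUnion fun P hP => hP.2.image2 _ hP.2
  have hQ' : ∀ (x : Euc d) (l : X) (p : Euc d × X), ((0 : Euc d), l) ∈ (Λ - x).carrier →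
      p ∈ (Λ - x).patch R → p ∈ Q := by
    intro x l p h0 hp
    obtain ⟨P, hP, y, hPy⟩ := hSP x
    have hinj : Function.Injective (fun p : Euc d × X => (p.1 + y, p.2)) := fun p q hpq => by
      simpa [Prod.ext_iff] using hpq
    have hfin : P.Finite :=
      Set.Finite.of_finite_image (hPy ▸ (Λ - x).finite_patch R) hinj.injOn
    have h0' : ((0 : Euc d), l) ∈ (Λ - x).patch R := ⟨h0, by
      simpa using (norm_nonneg _).trans_lt hp.2⟩
    rw [hPy] at hp h0'
    obtain ⟨p', hp', rfl⟩ := hp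
    obtain ⟨q', hq', hq0⟩ := h0'
    refine Set.mem_biUnion (x := P) ⟨hP, hfin⟩ ⟨p', hp', q', hq', ?_⟩
    have : q'.1 + y = 0 := congrArg Prod.fst hq0
    rw [eq_neg_of_add_eq_zero_right this]
    simp [sub_eq_add_neg]
  refine hQ.subset ?_
  rintro p ⟨T, ⟨o, ho, ho0⟩, hp⟩
  rw [← hQ.isClosed.closure_eq]
  refine Metric.mem_closure_iff.2 fun ε hε => ?_
  have hε' : 0 < min (ε / 2) ((R - ‖p.1‖) / 2) := lt_min (half_pos hε) (by linarith [hp.2])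
  obtain ⟨S, ⟨x, rfl⟩, ⟨o', ho', hoo'⟩, p', hp', hpp'⟩ :=
    ((mem_closure_iff_frequently.1 T.2).and_eventually
      ((DeloneSet.eventually_near T.1 ho hε').and (DeloneSet.eventually_near T.1 hp.1 hε'))).exists
  have h1 : dist o'.1 o.1 ≤ dist o' o := le_max_left _ _
  have h2 : dist p'.1 p.1 ≤ dist p' p := le_max_left _ _
  have h2' : dist p'.2 p.2 ≤ dist p' p := le_max_right _ _
  rw [ho0, dist_zero_right] at h1
  have h3 : dist (p'.1 - o'.1) p.1 < min ε (R - ‖p.1‖) := by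
    have : dist (p'.1 - o'.1) p.1 ≤ dist p'.1 p.1 + ‖o'.1‖ := by
      rw [dist_eq_norm, dist_eq_norm, sub_right_comm]
      exact norm_sub_le _ _
    refine lt_min ?_ ?_
    · linarith [min_le_left (ε / 2) ((R - ‖p.1‖) / 2)]
    · linarith [min_le_right (ε / 2) ((R - ‖p.1‖) / 2)]
  -- The approximating translate has a point only near the origin. Shifting by `o'.1` puts it
  -- exactly there.
  refine ⟨(p'.1 - o'.1, p'.2), hQ' (x + o'.1) o'.2 _ ?_ ⟨?_, ?_⟩, ?_⟩
  · rw [← DeloneSet.sub_sub_eq, DeloneSet.mem_sub]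
    simpa using ho'
  · rw [← DeloneSet.sub_sub_eq, DeloneSet.mem_sub]
    simpa using hp'
  · have := norm_le_norm_add_norm_sub' (p'.1 - o'.1) p.1
    rw [← dist_eq_norm (p'.1 - o'.1) p.1] at this
    simp only
    linarith [min_le_right ε (R - ‖p.1‖)]
  · rw [dist_comm]
    refine max_lt (h3.trans_le (min_le_left _ _)) ?_
    simp only
    linarith [min_le_left (ε / 2) ((R - ‖p.1‖) / 2)]

/-- Only finitely many elements occur in these patches, so they have a minimal distance, and
closeness below it is equality. -/
theorem patch_eq_mem_uniformity_of_isFLC (hΛ : Λ.IsFLC) (R : ℝ) :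
    {z : Hull Λ × Hull Λ | z.1 ∈ transversal Λ → z.2 ∈ transversal Λ →
      z.1.1.patch R = z.2.1.patch R} ∈ uniformity (Hull Λ) := by
  have hQ := finite_iUnion_patch_of_isFLC hΛ (R + 1)
  obtain ⟨ε, hε, hsep⟩ : ∃ ε > 0, ∀ p ∈ {p : Euc d × X | ∃ T ∈ transversal Λ, p ∈ T.1.patch (R + 1)},
      ∀ q ∈ {p : Euc d × X | ∃ T ∈ transversal Λ, p ∈ T.1.patch (R + 1)}, dist p q < ε → p = q := by
    generalize {p : Euc d × X | ∃ T ∈ transversal Λ, p ∈ T.1.patch (R + 1)} = Q at hQ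
    rcases Q.subsingleton_or_nontrivial with h | h
    · exact ⟨1, one_pos, fun p hp q hq _ => h hp hq⟩
    · refine ⟨Q.infsep, hQ.infsep_pos_iff_nontrivial.2 h, fun p hp q hq hpq => ?_⟩
      by_contra hne
      exact absurd (Set.infsep_le_dist_of_mem hp hq hne) (not_le.2 hpq)
  have key : ∀ S T : Hull Λ, S ∈ transversal Λ → T ∈ transversal Λ →
      (∀ p ∈ S.1.patch R, ∃ q ∈ T.1.carrier, dist q p < min ε 1) →
      S.1.patch R ⊆ T.1.patch R := by
    intro S T hS hT h p hp
    obtain ⟨q, hq, hqp⟩ := h p hp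
    have h1 : dist q.1 p.1 ≤ dist q p := le_max_left _ _
    have h2 := norm_le_norm_add_norm_sub' q.1 p.1
    rw [← dist_eq_norm] at h2
    have := hsep q ⟨T, hT, hq, by linarith [hp.2, min_le_right ε 1]⟩ p
      ⟨S, hS, hp.1, by linarith [hp.2]⟩ (hqp.trans_le (min_le_left _ _))
    subst this
    exact ⟨hq, hp.2⟩
  have hU := mem_uniformity_near (Λ := Λ) R (lt_min hε one_pos)
  filter_upwards [hU, UniformSpace.symm hU] with z hz hz' h1 h2
  exact Set.Subset.antisymm (key _ _ h1 h2 hz) (key _ _ h2 h1 hz')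

theorem eq_of_forall_patch_eq {S T : Hull Λ} (h : ∀ R, S.1.patch R = T.1.patch R) : S = T := by
  refine Hull.ext (DeloneSet.ext (Set.ext fun p => ?_))
  have := Set.ext_iff.1 (h (‖p.1‖ + 1)) p
  simpa [DeloneSet.patch] using this

/-- Each patch is locally constant on the transversal, hence constant on connected subsets, and the
patches together determine the element. -/
theorem isTotallyDisconnected_transversal (hΛ : Λ.IsFLC) :
    IsTotallyDisconnected (transversal Λ) := by
  intro t ht hpre S hS T hT
  refine eq_of_forall_patch_eq fun R => ?_
  let _ : TopologicalSpace (Set (Euc d × X)) := ⊥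
  have _ : DiscreteTopology (Set (Euc d × X)) := ⟨rfl⟩
  refine hpre.constant (f := fun S : Hull Λ => S.1.patch R) (fun S hS => ?_) hS hT
  refine (tendsto_const_nhds (x := S.1.patch R)).congr' ?_
  have := mem_nhds_left S (patch_eq_mem_uniformity_of_isFLC hΛ R)
  filter_upwards [mem_nhdsWithin_of_mem_nhds this, self_mem_nhdsWithin] with S' h1 h2
  exact h1 (ht hS) (ht h2)

theorem isTotallyDisconnected_of_countable {s : Set (Hull Λ)} (hs : s.Countable) :
    IsTotallyDisconnected s := by
  let _ := TopologicalSpace.metrizableSpaceMetric (Hull Λ)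
  exact hs.isTotallyDisconnected

theorem exists_forall_small_translation [CompactSpace X] [CompactSpace Y] {h : Hull Λ → Hull Λ'}
    (hc : Continuous h)
    (htd : ∀ T : Hull Λ, ∃ A : Set (Hull Λ'), IsTotallyDisconnected A ∧
      ∀ x y : Euc d, h (T - x) - y ∈ transversal Λ' → h (T - x) - y ∈ A) {ε : ℝ} (hε : 0 < ε) :
    ∃ δ > 0, ∀ (T : Hull Λ) (x : Euc d), ‖x‖ < δ → ∃ y : Euc d, ‖y‖ < ε ∧ h (T - x) = h T - y := by
  obtain ⟨r, hr, hsep⟩ := exists_isSeparatedBy Λ'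
  obtain ⟨R, hR, hcov⟩ := exists_isCoveringBy Λ'
  set η := min ε (r / 2) with hηdef
  have hη : 0 < η := by positivity
  have hηr : 2 * η ≤ r := by linarith [min_le_right ε (r / 2)]
  have huc := CompactSpace.uniformContinuous_of_continuous hc
  obtain ⟨δ, hδ, hδh⟩ := exists_forall_sub_mem (huc (mem_uniformity_near (Λ := Λ') (R + 1) hη))
  refine ⟨δ, hδ, fun T x hx => ?_⟩
  obtain ⟨p, hp, hpR⟩ := hcov (h T) 0
  rw [dist_zero_right] at hpR
  have hpp : p.1 ∈ (h T).1.points := ⟨p, hp, rfl⟩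
  have hnear : ∀ y ∈ Metric.ball (0 : Euc d) δ, ∃ q ∈ (h (T - y)).1.points, dist q p.1 < η := by
    intro y hy
    have := hδh T 0 y (by simpa using hy)
    rw [sub_zero] at this
    obtain ⟨q, hq, hqp⟩ := this p ⟨hp, by linarith⟩
    exact ⟨q.1, ⟨q, hq, rfl⟩, (le_max_left _ _).trans_lt hqp⟩
  -- The image recentred at the tracked point: a continuous map from a connected ball into `A`,
  -- hence constant. The displacement of the tracked point is the required `y`.
  let F : Euc d → Hull Λ' := fun y => h (T - y) - (h (T - y)).1.nearPoint η p.1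
  have hhc : Continuous fun y : Euc d => h (T - y) :=
    hc.comp (continuous_const.hullSub continuous_id)
  have hFc : ContinuousOn F (Metric.ball 0 δ) :=
    hhc.continuousOn.hullSub ((continuousOn_nearPoint hsep hηr p.1).comp hhc.continuousOn hnear)
  obtain ⟨A, hA, hAT⟩ := htd T
  have hFA : F '' Metric.ball 0 δ ⊆ A := by
    rintro _ ⟨y, hy, rfl⟩
    exact hAT _ _ (sub_mem_transversal.2 (DeloneSet.nearPoint_spec (hnear y hy)).1)
  have hsub := hA _ hFA ((convex_ball (0 : Euc d) δ).isPreconnected.image F hFc)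
  have hx' : x ∈ Metric.ball (0 : Euc d) δ := by simpa using hx
  have hF := hsub ⟨x, hx', rfl⟩ ⟨0, Metric.mem_ball_self hδ, rfl⟩
  have h0 : F 0 = h T - p.1 := by
    simp only [F, sub_zero]
    rw [(hsep _).nearPoint_eq hηr hpp (by simpa using hη)]
  rw [h0] at hF
  refine ⟨p.1 - (h (T - x)).1.nearPoint η p.1, ?_, ?_⟩
  · have := (DeloneSet.nearPoint_spec (hnear x hx')).2
    rw [dist_comm, dist_eq_norm] at this
    exact this.trans_le (min_le_left _ _)
  · rw [sub_eq_add_neg, ← sub_sub_eq, ← hF]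
    simp only [F]
    rw [sub_sub_eq, add_neg_cancel, sub_zero]

end Hull

/-! ### The cocycles of `h` and of its inverse, with linear bounds. -/

namespace Hull

open Filter

variable {Λ : DeloneSet d X} {Λ' : DeloneSet d Y}

theorem sub_left_cancel (haper : IsAperiodic Λ) {T : Hull Λ} {x y : Euc d} (h : T - x = T - y) :
    x = y := by
  have : T - x - (y - x) = T - x := by
    rw [sub_sub_eq, add_sub_cancel, ← h]
  exact (sub_eq_zero.1 (haper _ _ this)).symm

theorem isCocycleOf_unique (haper' : IsAperiodic Λ') {g : Hull Λ → Hull Λ'}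
    {α β : C(Hull Λ × Euc d, Euc d)} (hα : IsCocycleOf g α) (hβ : IsCocycleOf g β) : α = β := by
  ext1 ⟨T, x⟩
  exact sub_left_cancel haper' ((hα T x).symm.trans (hβ T x))

theorem exists_forall_bounded_translation {g : Hull Λ → Hull Λ'}
    (hg : ∀ ε > 0, ∃ δ > 0, ∀ (T : Hull Λ) (x : Euc d), ‖x‖ < δ →
      ∃ y : Euc d, ‖y‖ < ε ∧ g (T - x) = g T - y) :
    ∃ δ > 0, ∀ (n : ℕ) (T : Hull Λ) (x : Euc d), ‖x‖ < n * δ →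
      ∃ y : Euc d, ‖y‖ ≤ n ∧ g (T - x) = g T - y := by
  obtain ⟨δ, hδ, h⟩ := hg 1 one_pos
  refine ⟨δ, hδ, fun n => ?_⟩
  induction n with
  | zero =>
    intro T x hx
    simp only [Nat.cast_zero, zero_mul] at hx
    exact absurd hx (not_lt.2 (norm_nonneg x))
  | succ n ih =>
    intro T x hx
    -- The induction hypothesis is empty for `n = 0`, because its inequality is strict, so one step
    -- is treated directly. For larger `n` the vector is cut at the fraction `n / (n + 1)`.
    rcases n.eq_zero_or_pos with rfl | hn
    · obtain ⟨y, hy, hyT⟩ := h T x (by simpa using hx)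
      exact ⟨y, by simpa using hy.le, hyT⟩
    have hn' : (0 : ℝ) < n := Nat.cast_pos.2 hn
    have hx1 : ‖((n : ℝ) / (n + 1)) • x‖ < n * δ := by
      rw [norm_smul, Real.norm_of_nonneg (by positivity), div_mul_eq_mul_div,
        div_lt_iff₀ (by positivity)]
      push_cast at hx
      nlinarith
    have hx2 : ‖((1 : ℝ) / (n + 1)) • x‖ < δ := by
      rw [norm_smul, Real.norm_of_nonneg (by positivity), div_mul_eq_mul_div,
        div_lt_iff₀ (by positivity)]
      push_cast at hx
      linarith
    obtain ⟨y, hy, hyT⟩ := ih T _ hx1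
    obtain ⟨z, hz, hzT⟩ := h (T - ((n : ℝ) / (n + 1)) • x) _ hx2
    refine ⟨y + z, ?_, ?_⟩
    · push_cast
      exact (norm_add_le y z).trans (by linarith)
    · rw [sub_sub_eq, ← add_smul, ← add_div, div_self (by positivity), one_smul] at hzT
      rw [hzT, hyT, sub_sub_eq]

/-- Continuity is a closed graph argument: the values are locally bounded, and every cluster point
satisfies the defining equation, whose solution is unique by aperiodicity. -/
theorem exists_isCocycleOf [CompactSpace X] [CompactSpace Y] (haper' : IsAperiodic Λ')
    {g : Hull Λ → Hull Λ'} (hc : Continuous g)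
    (hg : ∀ ε > 0, ∃ δ > 0, ∀ (T : Hull Λ) (x : Euc d), ‖x‖ < δ →
      ∃ y : Euc d, ‖y‖ < ε ∧ g (T - x) = g T - y) :
    ∃ α : weakCocycles Λ, IsCocycleOf g α.1 := by
  obtain ⟨δ, hδ, hb⟩ := exists_forall_bounded_translation hg
  have hex : ∀ z : Hull Λ × Euc d, ∃ y : Euc d, g (z.1 - z.2) = g z.1 - y := by
    intro z
    obtain ⟨n, hn⟩ := exists_nat_gt (‖z.2‖ / δ)
    obtain ⟨y, -, hy⟩ := hb n z.1 z.2 ((div_lt_iff₀ hδ).1 hn)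
    exact ⟨y, hy⟩
  choose a ha using hex
  have hbd : ∀ (n : ℕ) (z : Hull Λ × Euc d), ‖z.2‖ < n * δ → ‖a z‖ ≤ n := by
    intro n z hz
    obtain ⟨y, hy, hyT⟩ := hb n z.1 z.2 hz
    rwa [sub_left_cancel haper' ((ha z).symm.trans hyT)]
  have hac : Continuous a := by
    refine continuous_iff_continuousAt.2 fun z => ?_
    obtain ⟨n, hn⟩ := exists_nat_gt (‖z.2‖ / δ)
    rw [div_lt_iff₀ hδ] at hn
    refine (isCompact_closedBall (0 : Euc d) n).tendsto_nhds_of_unique_mapClusterPt ?_ ?_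
    · have : ∀ᶠ w : Hull Λ × Euc d in 𝓝 z, ‖w.2‖ < n * δ :=
        (continuous_snd.norm.tendsto z).eventually (gt_mem_nhds hn)
      filter_upwards [this] with w hw
      simpa using hbd n w hw
    · intro y _ hy
      obtain ⟨U, hU, hUy⟩ := mapClusterPt_iff_ultrafilter.1 hy
      refine sub_left_cancel haper' (T := g z.1) (Eq.trans ?_ (ha z))
      have h1 : Tendsto (fun w : Hull Λ × Euc d => g (w.1 - w.2)) U (𝓝 (g (z.1 - z.2))) :=
        ((hc.comp continuous_sub).tendsto z).mono_left hU
      have h2 : Tendsto (fun w : Hull Λ × Euc d => g w.1 - a w) U (𝓝 (g z.1 - y)) :=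
        (continuous_sub.tendsto (g z.1, y)).comp
          ((((hc.comp continuous_fst).tendsto z).mono_left hU).prodMk_nhds hUy)
      simp only [ha] at h1
      rw [ha z]
      exact tendsto_nhds_unique h2 h1
  refine ⟨⟨⟨a, hac⟩, fun T x y => ?_⟩, fun T x => ha (T, x)⟩
  refine sub_left_cancel haper' (T := g T) ?_
  simp only [ContinuousMap.coe_mk]
  rw [← sub_sub_eq, ← ha (T, x), ← ha (T - x, y), ← ha (T, x + y), sub_sub_eq]

section Cocycle

variable {α : C(Hull Λ × Euc d, Euc d)}

theorem cocycle_zero (hα : α ∈ weakCocycles Λ) (T : Hull Λ) : α (T, 0) = 0 := by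
  have := hα T 0 0
  rw [sub_zero, add_zero] at this
  simpa using this

theorem cocycle_sub (hα : α ∈ weakCocycles Λ) (T : Hull Λ) (x y : Euc d) :
    α (T - x, y) = α (T, x + y) - α (T, x) :=
  eq_sub_of_add_eq' (hα T x y)

/-- The cocycle `α + δs`. -/
def addCoboundary (α : weakCocycles Λ) (s : C(Hull Λ, Euc d)) : weakCocycles Λ :=
  ⟨⟨fun z => α.1 z + (s (z.1 - z.2) - s z.1),
      α.1.continuous.add ((s.continuous.comp continuous_sub).sub (s.continuous.comp continuous_fst))⟩,
    fun T x y => by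
      simp only [ContinuousMap.coe_mk]
      rw [← α.2 T x y, sub_sub_eq]
      abel⟩

theorem addCoboundary_apply (α : weakCocycles Λ) (s : C(Hull Λ, Euc d)) (T : Hull Λ) (v : Euc d) :
    (addCoboundary α s).1 (T, v) = α.1 (T, v) + (s (T - v) - s T) := rfl

theorem norm_cocycle_nsmul_le (hα : α ∈ weakCocycles Λ) {K : ℝ} {x : Euc d}
    (hK : ∀ T, ‖α (T, x)‖ ≤ K) (n : ℕ) (T : Hull Λ) : ‖α (T, n • x)‖ ≤ n * K := by
  induction n with
  | zero => simp [cocycle_zero hα]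
  | succ n ih =>
    rw [succ_nsmul, ← hα T]
    refine (norm_add_le _ _).trans ?_
    push_cast
    linarith [hK (T - n • x)]

theorem exists_norm_cocycle_le_of_norm_le [CompactSpace X] (α : C(Hull Λ × Euc d, Euc d)) (M : ℝ) :
    ∃ K, ∀ (T : Hull Λ) (x : Euc d), ‖x‖ ≤ M → ‖α (T, x)‖ ≤ K := by
  obtain ⟨K, hK⟩ := ((isCompact_univ (X := Hull Λ)).prod
    (isCompact_closedBall (0 : Euc d) M)).exists_bound_of_continuousOn α.continuous.continuousOn
  exact ⟨K, fun T x hx => hK (T, x) ⟨trivial, by simpa using hx⟩⟩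

/-- Cut `x` into `⌊‖x‖⌋₊ + 1` equal steps of length at most one, on which compactness bounds the
cocycle. -/
theorem exists_norm_cocycle_le [CompactSpace X] (hα : α ∈ weakCocycles Λ) :
    ∃ K > 0, ∀ (T : Hull Λ) (x : Euc d), ‖α (T, x)‖ ≤ K * (‖x‖ + 1) := by
  obtain ⟨K, hK⟩ := exists_norm_cocycle_le_of_norm_le α 1
  refine ⟨max K 1, by positivity, fun T x => ?_⟩
  have hn : (0 : ℝ) < (⌊‖x‖⌋₊ + 1 : ℕ) := by positivity
  have hlt : ‖x‖ < (⌊‖x‖⌋₊ + 1 : ℕ) := by exact_mod_cast Nat.lt_floor_add_one ‖x‖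
  have hle : ((⌊‖x‖⌋₊ + 1 : ℕ) : ℝ) ≤ ‖x‖ + 1 := by
    push_cast
    linarith [Nat.floor_le (norm_nonneg x)]
  generalize ⌊‖x‖⌋₊ + 1 = n at *
  have hx : x = n • ((n : ℝ)⁻¹ • x) := by
    rw [← Nat.cast_smul_eq_nsmul ℝ, smul_smul, mul_inv_cancel₀ hn.ne', one_smul]
  have hx1 : ‖(n : ℝ)⁻¹ • x‖ ≤ 1 := by
    rw [norm_smul, norm_inv, Real.norm_of_nonneg hn.le, inv_mul_le_iff₀ hn, mul_one]
    exact hlt.le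
  have := norm_cocycle_nsmul_le hα (fun S => hK S _ hx1) n T
  rw [← hx] at this
  calc ‖α (T, x)‖ ≤ n * K := this
    _ ≤ n * max K 1 := by gcongr; exact le_max_left _ _
    _ = max K 1 * n := mul_comm _ _
    _ ≤ max K 1 * (‖x‖ + 1) := by gcongr

end Cocycle

/-- The cocycles of `h` and `h.symm` invert each other along orbits, so the linear upper bound for
`β` is a lower bound for `α`. -/
theorem exists_norm_le_cocycle [CompactSpace Y] (haper : IsAperiodic Λ) (h : Hull Λ ≃ₜ Hull Λ')
    {α : C(Hull Λ × Euc d, Euc d)} (hα : IsCocycleOf h α) (β : weakCocycles Λ')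
    (hβ : IsCocycleOf h.symm β.1) :
    ∃ K > 0, ∀ (T : Hull Λ) (x : Euc d), ‖x‖ ≤ K * (‖α (T, x)‖ + 1) := by
  obtain ⟨K, hK, hb⟩ := exists_norm_cocycle_le β.2
  refine ⟨K, hK, fun T x => ?_⟩
  have : β.1 (h T, α (T, x)) = x := by
    refine sub_left_cancel haper (T := T) ?_
    have := hβ (h T) (α (T, x))
    rw [← hα T x, h.symm_apply_apply, h.symm_apply_apply] at this
    exact this.symm
  have := hb (h T) (α (T, x))
  rwa [‹β.1 (h T, α (T, x)) = x›] at this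

theorem exists_cocycles_of_homeomorph [CompactSpace X] [CompactSpace Y] (haper : IsAperiodic Λ)
    (haper' : IsAperiodic Λ') (h : Hull Λ ≃ₜ Hull Λ')
    (hh : IsOrbitEquivalence h ∨ (Λ.IsFLC ∧ Λ'.IsFLC)) :
    (∃ α : weakCocycles Λ, IsCocycleOf h α.1) ∧
      ∃ β : weakCocycles Λ', IsCocycleOf h.symm β.1 := by
  constructor
  · refine exists_isCocycleOf haper' h.continuous fun ε hε =>
      exists_forall_small_translation h.continuous (fun T => ?_) hε
    rcases hh with hh | ⟨-, hΛ'⟩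
    -- All `h (T - x)` lie in the orbit of `h T`, which meets the transversal once for each of
    -- countably many points.
    · refine ⟨_, isTotallyDisconnected_of_countable
        ((h T).1.countable_points.image fun y => h T - y), fun x y hxy => ?_⟩
      obtain ⟨z, hz : h T - z = h (T - x)⟩ := (hh T).subset ⟨T - x, ⟨x, rfl⟩, rfl⟩
      rw [← hz, sub_sub_eq] at hxy ⊢
      exact ⟨_, sub_mem_transversal.1 hxy, rfl⟩
    · exact ⟨_, isTotallyDisconnected_transversal hΛ', fun x y h => h⟩
  · refine exists_isCocycleOf haper h.symm.continuous fun ε hε =>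
      exists_forall_small_translation h.symm.continuous (fun T => ?_) hε
    rcases hh with hh | ⟨hΛ, -⟩
    · refine ⟨_, isTotallyDisconnected_of_countable
        ((h.symm T).1.countable_points.image fun y => h.symm T - y), fun x y hxy => ?_⟩
      obtain ⟨_, ⟨z, rfl⟩, hz⟩ := (hh (h.symm T)).superset
        (show T - x ∈ _ from ⟨x, by simp⟩)
      rw [← hz] at hxy ⊢
      simp only [h.symm_apply_apply] at hxy ⊢
      rw [sub_sub_eq] at hxy ⊢
      exact ⟨_, sub_mem_transversal.1 hxy, rfl⟩
    · exact ⟨_, isTotallyDisconnected_transversal hΛ, fun x y h => h⟩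

end Hull

/-! ### Smoothing a cocycle by convolution. -/

namespace Hull

open Filter
open scoped Convolution

variable {Λ : DeloneSet d X}

section Convolution

variable {F G : Type} [NormedAddCommGroup F] [NormedSpace ℝ F]
  [NormedAddCommGroup G] [NormedSpace ℝ G]

theorem continuous_convolution_zero [CompactSpace X] (a : C(Hull Λ × Euc d, Euc d)) (L : Euc d →L[ℝ] F →L[ℝ] G)
    {g : Euc d → F} (hg : Continuous g) (hcs : HasCompactSupport g) :
    Continuous fun T : Hull Λ => ((fun t => a (T, t)) ⋆[L, volume] g) 0 := by
  have hK : IsCompact (-tsupport g) := hcs.isCompact.neg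
  have : (fun T : Hull Λ => ((fun t => a (T, t)) ⋆[L, volume] g) 0) =
      fun T : Hull Λ => ∫ t in -tsupport g, L (a (T, t)) (g (0 - t)) := by
    funext T
    rw [convolution_def, setIntegral_eq_integral_of_forall_compl_eq_zero]
    intro t ht
    rw [image_eq_zero_of_notMem_tsupport (f := g), map_zero]
    simpa using ht
  rw [this]
  refine continuous_parametric_integral_of_continuous ?_ hK
  have h1 : Continuous fun z : Hull Λ × Euc d => g (0 - z.2) := by fun_prop
  exact (L.continuous.comp a.continuous).clm_apply h1

/-- All derivatives fall on `g`. Each one changes the bilinear map and its spaces, so `F` and `G`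
vary in the induction. -/
theorem continuous_iteratedFDeriv_convolution [CompactSpace X] (a : C(Hull Λ × Euc d, Euc d))
    (L : Euc d →L[ℝ] F →L[ℝ] G) {g : Euc d → F} (hg : ContDiff ℝ ∞ g)
    (hcs : HasCompactSupport g) (n : ℕ) :
    Continuous fun T : Hull Λ =>
      iteratedFDeriv ℝ n ((fun t => a (T, t)) ⋆[L, volume] g) 0 := by
  induction n generalizing F G with
  | zero =>
    simp only [iteratedFDeriv_zero_eq_comp, Function.comp_apply]
    exact (LinearIsometryEquiv.continuous _).comp (continuous_convolution_zero a L hg.continuous hcs)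
  | succ n ih =>
    have hT : ∀ T : Hull Λ, LocallyIntegrable (fun t => a (T, t)) volume := fun T =>
      (a.continuous.comp (Continuous.prodMk_right T)).locallyIntegrable
    have hfd : ∀ T : Hull Λ, fderiv ℝ ((fun t => a (T, t)) ⋆[L, volume] g) =
        (fun t => a (T, t)) ⋆[L.precompR (Euc d), volume] fderiv ℝ g := fun T => by
      funext x
      exact (hcs.hasFDerivAt_convolution_right L (hT T)
        (hg.of_le (by exact_mod_cast le_top)) x).fderiv
    simp only [iteratedFDeriv_succ_eq_comp_right, Function.comp_apply, hfd]
    exact (LinearIsometryEquiv.continuous _).comp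
      (ih (L.precompR (Euc d)) (hg.fderiv_right (by simp)) (hcs.fderiv ℝ))

end Convolution

/-- Pattern equivariance with a radius that is locally uniform in the second variable. -/
def IsUniformlyPE (α : C(Hull Λ × Euc d, Euc d)) : Prop :=
  ∀ M : ℝ, ∃ R > 0, ∀ T T' : Hull Λ, T.1.patch R = T'.1.patch R →
    ∀ x : Euc d, ‖x‖ ≤ M → α (T, x) = α (T', x)

theorem patch_sub_eq {T T' : DeloneSet d X} {R : ℝ} {x : Euc d}
    (h : T.patch (R + ‖x‖) = T'.patch (R + ‖x‖)) : (T - x).patch R = (T' - x).patch R := by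
  have key : ∀ T T' : DeloneSet d X, T.patch (R + ‖x‖) = T'.patch (R + ‖x‖) →
      (T - x).patch R ⊆ (T' - x).patch R := by
    intro T T' h p hp
    have : (p.1 + x, p.2) ∈ T.patch (R + ‖x‖) :=
      ⟨hp.1, (norm_add_le _ _).trans_lt (by linarith [hp.2])⟩
    rw [h] at this
    exact ⟨this.1, hp.2⟩
  exact Set.Subset.antisymm (key T T' h) (key T' T h.symm)

theorem _root_.Tiling.IsStronglyPE.sub {A : Type*} {f : Hull Λ → A} (hf : IsStronglyPE f)
    (x : Euc d) : IsStronglyPE fun T : Hull Λ => f (T - x) := by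
  obtain ⟨R, hR, h⟩ := hf
  exact ⟨R + ‖x‖, by positivity, fun T T' hT => h _ _ (patch_sub_eq hT)⟩

set_option maxHeartbeats 400000 in
-- With `A T` the convolution of `α (T, ·)` and a bump of integral one, and `s T = A T 0`, the
-- cocycle identity gives `A T x = α (T, x) + s (T - x)`. So `A T - s T` is a smooth cocycle
-- differing from `α` by `δs`.
theorem exists_smooth_cohomologous [CompactSpace X] (α : weakCocycles Λ) :
    ∃ (η : PEForm Λ) (s : C(Hull Λ, Euc d)), η.HasPrimitive (addCoboundary α s).1 ∧
      (IsUniformlyPE α.1 → IsStronglyPE s ∧ IsStronglyPE η.toFun) := by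
  let φ : ContDiffBump (0 : Euc d) := ⟨1, 2, one_pos, one_lt_two⟩
  let ρ : Euc d → ℝ := φ.normed volume
  have hρ : ContDiff ℝ ∞ ρ := φ.contDiff_normed
  have hρc : HasCompactSupport ρ := φ.hasCompactSupport_normed
  have hρ0 : ∀ t, 2 ≤ ‖t‖ → ρ t = 0 := fun t ht => by
    have : t ∉ Function.support ρ := by
      rw [φ.support_normed_eq]
      simpa [φ] using ht
    simpa using this
  let L : Euc d →L[ℝ] ℝ →L[ℝ] Euc d := (ContinuousLinearMap.lsmul ℝ ℝ).flip
  let A : Hull Λ → Euc d → Euc d := fun T => (fun t => α.1 (T, t)) ⋆[L, volume] ρ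
  have hA : ∀ T x, A T x = ∫ t, ρ (x - t) • α.1 (T, t) := fun T x => rfl
  have hαT : ∀ T : Hull Λ, Continuous fun t => α.1 (T, t) := fun T =>
    α.1.continuous.comp (Continuous.prodMk_right T)
  have hAs : ∀ T, ContDiff ℝ ∞ (A T) := fun T =>
    hρc.contDiff_convolution_right L (hαT T).locallyIntegrable hρ
  let s : C(Hull Λ, Euc d) := ⟨fun T => A T 0, continuous_convolution_zero α.1 L hρ.continuous hρc⟩
  have hsA : ∀ (T : Hull Λ) (x : Euc d), A T x = α.1 (T, x) + s (T - x) := by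
    intro T x
    have h1 : s (T - x) = ∫ t, (ρ (x - (x + t)) • α.1 (T, x + t) - ρ (0 - t) • α.1 (T, x)) := by
      refine integral_congr_ae (Eventually.of_forall fun t => ?_)
      change ρ (0 - t) • α.1 (T - x, t) = _
      simp only [sub_add_cancel_left, zero_sub]
      rw [cocycle_sub α.2, smul_sub]
    have hi : Integrable fun t => ρ (x - t) • α.1 (T, t) := by
      refine Continuous.integrable_of_hasCompactSupport ?_ ?_
      · exact (hρ.continuous.comp (by fun_prop)).smul (hαT T)
      · exact (hρc.comp_homeomorph (Homeomorph.subLeft x)).smul_right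
    have hi2 : Integrable fun t => ρ (0 - t) :=
      (hρ.continuous.integrable_of_hasCompactSupport hρc).comp_sub_left 0
    rw [h1, integral_sub (hi.comp_add_left x) (hi2.smul_const _),
      integral_add_left_eq_self (fun t => ρ (x - t) • α.1 (T, t)) x, integral_smul_const,
      integral_sub_left_eq_self ρ volume 0, φ.integral_normed, one_smul, ← hA]
    abel
  have hfd : ∀ (T : Hull Λ) (x : Euc d), fderiv ℝ (A (T - x)) 0 = fderiv ℝ (A T) x := by
    intro T x
    have : A (T - x) = fun v => A T (x + v) - α.1 (T, x) := by
      funext v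
      rw [hsA, hsA, cocycle_sub α.2, sub_sub_eq]
      abel
    rw [this, fderiv_sub_const, fderiv_comp_add_left, add_zero]
  have hfd' : ∀ T : Hull Λ, (fun x => fderiv ℝ (A (T - x)) 0) = fderiv ℝ (A T) := fun T =>
    funext (hfd T)
  let η : PEForm Λ :=
    { toFun := fun T => fderiv ℝ (A T) 0
      smooth := fun T => by
        rw [hfd']
        exact (hAs T).fderiv_right (by simp)
      equivariant := fun n => by
        have h1 : ∀ T : Hull Λ, fderiv ℝ (A T) =
            (fun t => α.1 (T, t)) ⋆[L.precompR (Euc d), volume] fderiv ℝ ρ := fun T => by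
          funext x
          exact (hρc.hasFDerivAt_convolution_right L (hαT T).locallyIntegrable
            (hρ.of_le (by exact_mod_cast le_top)) x).fderiv
        refine (continuous_iteratedFDeriv_convolution α.1 (L.precompR (Euc d))
          (hρ.fderiv_right (m := ∞) (by simp)) (hρc.fderiv ℝ) n).congr fun T => ?_
        rw [← h1, ← hfd' T]
      closed := fun T x u v => by
        rw [hfd']
        exact ((hAs T).contDiffAt (x := x)).isSymmSndFDerivAt
          (by rw [minSmoothness_of_isRCLikeNormedField]; exact WithTop.coe_le_coe.2 (le_top : (2 : ℕ∞) ≤ ⊤)) u v }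
  refine ⟨η, s, fun T x => ?_, fun hα => ⟨?_, ?_⟩⟩
  · have : (fun v => (addCoboundary α s).1 (T, v)) = fun v => A T v - s T := by
      funext v
      rw [hsA, addCoboundary_apply]
      abel
    rw [this]
    change HasFDerivAt _ (fderiv ℝ (A (T - x)) 0) x
    rw [hfd]
    exact (((hAs T).differentiable (by simp)) x).hasFDerivAt.sub_const _
  · obtain ⟨R, hR, h⟩ := hα 2
    refine ⟨R, hR, fun T T' hT => ?_⟩
    refine integral_congr_ae (Eventually.of_forall fun t => ?_)
    change ρ (0 - t) • α.1 (T, t) = ρ (0 - t) • α.1 (T', t)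
    rcases le_total ‖t‖ 2 with ht | ht
    · rw [h T T' hT t ht]
    · rw [hρ0 _ (by simpa using ht), zero_smul, zero_smul]
  -- The derivative at `0` needs `A T` on the unit ball, and the bump reaches a further distance
  -- `2`.
  · obtain ⟨R, hR, h⟩ := hα 3
    refine ⟨R, hR, fun T T' hT => ?_⟩
    refine EventuallyEq.fderiv_eq ?_
    filter_upwards [Metric.ball_mem_nhds (0 : Euc d) one_pos] with x hx
    rw [mem_ball_zero_iff] at hx
    rw [hA, hA]
    refine integral_congr_ae (Eventually.of_forall fun t => ?_)
    simp only
    rcases le_total ‖t‖ 3 with ht | ht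
    · rw [h T T' hT t ht]
    · have := norm_le_norm_add_norm_sub x t
      rw [hρ0 _ (by linarith), zero_smul, zero_smul]

end Hull

/-! ### Averages of cocycles and the ergodic argument. -/

namespace Hull

open Filter

variable {Λ : DeloneSet d X} {μ : Measure (Hull Λ)}

theorem continuous_sub_right (y : Euc d) : Continuous fun T : Hull Λ => T - y :=
  continuous_id.hullSub continuous_const

theorem measurePreserving_sub (hμ : IsInvariantProbability μ) (y : Euc d) :
    MeasurePreserving (fun T : Hull Λ => T - y) μ μ :=
  ⟨(continuous_sub_right y).measurable, hμ.invariant y⟩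

theorem _root_.Tiling.PEForm.continuous (η : PEForm Λ) : Continuous η.toFun := by
  have := η.equivariant 0
  simp only [iteratedFDeriv_zero_eq_comp, Function.comp_apply, sub_zero] at this
  exact ((continuousMultilinearCurryFin0 ℝ (Euc d) (Euc d →L[ℝ] Euc d)).continuous.comp this).congr
    fun T => by simp

/-- If `{f > 0}` is not null, conditioning on it gives an invariant probability, which must be `μ`.
So `f` has a constant sign almost everywhere, and mean zero makes it vanish. -/
theorem ae_eq_zero_of_invariant (hμ : IsUniquelyErgodic μ) {f : Hull Λ → ℝ} (hm : Measurable f)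
    (hint : Integrable f μ) (hinv : ∀ y : Euc d, (fun T : Hull Λ => f (T - y)) =ᵐ[μ] f)
    (h0 : ∫ T, f T ∂μ = 0) : f =ᵐ[μ] 0 := by
  have hprob := hμ.1.isProbability
  have hA : MeasurableSet {T | 0 < f T} := measurableSet_lt measurable_const hm
  by_cases hA0 : μ {T | 0 < f T} = 0
  · have hle : 0 ≤ᵐ[μ] -f := by
      have : ∀ᵐ T ∂μ, ¬ 0 < f T := by simpa [ae_iff] using hA0
      filter_upwards [this] with T hT
      simpa using hT
    have := (integral_eq_zero_iff_of_nonneg_ae hle hint.neg).1 (by simp [integral_neg, h0])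
    filter_upwards [this] with T hT
    simpa using hT
  · have hcond : IsInvariantProbability (ProbabilityTheory.cond μ {T | 0 < f T}) := by
      refine ⟨ProbabilityTheory.cond_isProbabilityMeasure hA0, fun y => ?_⟩
      refine Measure.ext fun B hB => ?_
      have hτ := (continuous_sub_right (Λ := Λ) y).measurable
      rw [Measure.map_apply hτ hB, ProbabilityTheory.cond_apply hA,
        ProbabilityTheory.cond_apply hA]
      congr 1
      rw [← (measurePreserving_sub hμ.1 y).measure_preimage (hA.inter hB).nullMeasurableSet]
      refine measure_congr ?_
      filter_upwards [hinv y] with T hT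
      refine propext ?_
      change (0 < f T ∧ T - y ∈ B) ↔ (0 < f (T - y) ∧ T - y ∈ B)
      rw [hT]
    have heq := hμ.2 _ hcond
    have hae : ∀ᵐ T ∂μ, 0 < f T := by
      rw [ae_iff, ← heq, ProbabilityTheory.cond_apply hA]
      have : {T | 0 < f T} ∩ {T | ¬ 0 < f T} = ∅ := by
        ext T
        simp
      rw [this, measure_empty, mul_zero]
    exact (integral_eq_zero_iff_of_nonneg_ae (hae.mono fun T hT => hT.le) hint).1 h0

section Compact

variable [CompactSpace X]

theorem integrable_of_continuous [IsFiniteMeasure μ] {E : Type*} [NormedAddCommGroup E]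
    {f : Hull Λ → E} (hf : Continuous f) : Integrable f μ :=
  hf.integrable_of_hasCompactSupport (HasCompactSupport.of_compactSpace f)

theorem integral_sub_eq (hμ : IsInvariantProbability μ) {E : Type*} [NormedAddCommGroup E]
    [NormedSpace ℝ E] {f : Hull Λ → E} (hf : Continuous f) (y : Euc d) :
    ∫ T, f (T - y) ∂μ = ∫ T, f T ∂μ := by
  have := hμ.isProbability
  have h := integral_map (μ := μ) (φ := fun T : Hull Λ => T - y) (f := f)
    (continuous_sub_right y).aemeasurable (by
      rw [hμ.invariant y]
      exact (integrable_of_continuous hf).aestronglyMeasurable)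
  rw [hμ.invariant y] at h
  exact h.symm

/-- The average of a closed form in the direction `x` is the average of its primitive at `x`. -/
theorem integral_form_apply (hμ : IsInvariantProbability μ) (η : PEForm Λ) {β : weakCocycles Λ}
    (hη : η.HasPrimitive β.1) (x : Euc d) : ∫ T, η.toFun T x ∂μ = ∫ T, β.1 (T, x) ∂μ := by
  have := hμ.isProbability
  have hηc : Continuous fun T : Hull Λ => η.toFun T x := η.continuous.clm_apply continuous_const
  have hjc : Continuous fun z : ℝ × Hull Λ => η.toFun (z.2 - z.1 • x) x :=
    hηc.comp (continuous_snd.hullSub (by fun_prop))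
  have hβ : ∀ T : Hull Λ, β.1 (T, x) = ∫ t in (0 : ℝ)..1, η.toFun (T - t • x) x := by
    intro T
    rw [intervalIntegral.integral_eq_sub_of_hasDerivAt (f := fun t : ℝ => β.1 (T, t • x))]
    · simp [cocycle_zero β.2]
    · intro t _
      have h1 : HasDerivAt (fun t : ℝ => t • x) x t := by
        simpa using (hasDerivAt_id t).smul_const x
      exact (hη T (t • x)).comp_hasDerivAt t h1
    · exact (hjc.comp (continuous_id.prodMk continuous_const)).intervalIntegrable _ _
  have hint : Integrable (Function.uncurry fun (t : ℝ) (T : Hull Λ) => η.toFun (T - t • x) x)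
      ((volume.restrict (Set.uIoc (0 : ℝ) 1)).prod μ) := by
    obtain ⟨K, hK⟩ := isCompact_univ.exists_bound_of_continuousOn hηc.continuousOn
    rw [Set.uIoc_of_le zero_le_one]
    exact Integrable.of_bound hjc.aestronglyMeasurable K
      (Eventually.of_forall fun z => hK _ trivial)
  simp only [hβ]
  -- After Fubini the inner average does not depend on `t`, by invariance of `μ`.
  rw [← intervalIntegral_integral_swap hint]
  simp only [integral_sub_eq hμ hηc]
  simp

theorem integral_coboundary (hμ : IsInvariantProbability μ) (s : C(Hull Λ, Euc d)) (x : Euc d) :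
    ∫ T, (s (T - x) - s T) ∂μ = 0 := by
  have := hμ.isProbability
  have hc : Continuous fun T : Hull Λ => s (T - x) := s.continuous.comp (continuous_sub_right x)
  rw [integral_sub (integrable_of_continuous hc)
    (integrable_of_continuous s.continuous), integral_sub_eq hμ s.continuous, sub_self]

theorem integral_cocycle_nsmul (hμ : IsInvariantProbability μ) (α : weakCocycles Λ) (x : Euc d)
    (n : ℕ) : ∫ T, α.1 (T, n • x) ∂μ = n • ∫ T, α.1 (T, x) ∂μ := by
  have := hμ.isProbability
  have hc : ∀ y, Continuous fun T : Hull Λ => α.1 (T, y) := fun y =>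
    α.1.continuous.comp (Continuous.prodMk_left y)
  induction n with
  | zero => simp [cocycle_zero α.2]
  | succ n ih =>
    have : ∀ T : Hull Λ, α.1 (T, (n + 1) • x) = α.1 (T, n • x) + α.1 (T - n • x, x) := fun T => by
      rw [α.2 T, succ_nsmul]
    have hc' : Continuous fun T : Hull Λ => α.1 (T - n • x, x) :=
      (hc x).comp (continuous_sub_right _)
    simp only [this]
    rw [integral_add (integrable_of_continuous (hc _)) (integrable_of_continuous hc'),
      integral_sub_eq hμ (hc x), ih, succ_nsmul]

theorem compMeasurePreserving_toLp [IsFiniteMeasure μ] {τ : C(Hull Λ, Hull Λ)}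
    (hτ : MeasurePreserving τ μ μ) (g : C(Hull Λ, Euc d)) :
    Lp.compMeasurePreserving τ hτ (ContinuousMap.toLp 2 μ ℝ g) =
      ContinuousMap.toLp 2 μ ℝ (g.comp τ) := by
  refine Lp.ext ?_
  refine (Lp.coeFn_compMeasurePreserving _ hτ).trans ?_
  exact (hτ.quasiMeasurePreserving.ae_eq_comp (ContinuousMap.coeFn_toLp μ g)).trans
    (ContinuousMap.coeFn_toLp μ (g.comp τ)).symm

/-- A cocycle of mean zero in the direction `x` grows sublinearly in that direction, in the mean. -/
theorem tendsto_toLp_cocycle_nsmul (hμ : IsUniquelyErgodic μ) [IsFiniteMeasure μ]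
    (α : weakCocycles Λ) {x : Euc d}
    (h0 : ∫ T, α.1 (T, x) ∂μ = 0) (a : ℕ → C(Hull Λ, Euc d))
    (ha : ∀ n T, a n T = (n : ℝ)⁻¹ • α.1 (T, n • x)) :
    Tendsto (fun n => ContinuousMap.toLp (E := Euc d) 2 μ ℝ (a n)) atTop (𝓝 0) := by
  let τ : Euc d → C(Hull Λ, Hull Λ) := fun y => ⟨fun T => T - y, continuous_sub_right y⟩
  have hτ : ∀ y, MeasurePreserving (τ y) μ μ := fun y => measurePreserving_sub hμ.1 y
  let J : C(Hull Λ, Euc d) →L[ℝ] Lp (Euc d) 2 μ := ContinuousMap.toLp 2 μ ℝ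
  let U : Euc d → Lp (Euc d) 2 μ →L[ℝ] Lp (Euc d) 2 μ := fun y =>
    (Lp.compMeasurePreservingₗᵢ ℝ (τ y) (hτ y)).toContinuousLinearMap
  have hUJ : ∀ y g, U y (J g) = J (g.comp (τ y)) := fun y g => compMeasurePreserving_toLp (hτ y) g
  let A : Euc d → C(Hull Λ, Euc d) := fun y =>
    ⟨fun T => α.1 (T, y), α.1.continuous.comp (Continuous.prodMk_left y)⟩
  have haA : ∀ n, a n = (n : ℝ)⁻¹ • A (n • x) := fun n => ContinuousMap.ext fun T => ha n T
  have hiter : ∀ n : ℕ, (U x)^[n] (J (A x)) = J ((A x).comp (τ (n • x))) := by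
    intro n
    induction n with
    | zero =>
      have : (A x).comp (τ (0 • x)) = A x := by
        ext1 T
        simp [τ, sub_zero]
      rw [this, Function.iterate_zero, id]
    | succ n ih =>
      rw [Function.iterate_succ_apply', ih, hUJ]
      congr 1
      ext1 T
      change α.1 (T - x - n • x, x) = α.1 (T - (n + 1) • x, x)
      rw [sub_sub_eq, succ_nsmul']
  -- By the cocycle identity `α (T, n • x)` is the Birkhoff sum of `α (·, x)` under translation by
  -- `x`.
  have hsum : ∀ n : ℕ, birkhoffSum (U x) id n (J (A x)) = J (A (n • x)) := by
    intro n
    induction n with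
    | zero =>
      have : A (0 • x) = 0 := by
        ext1 T
        simp [A, cocycle_zero α.2]
      rw [this]
      simp
    | succ n ih =>
      rw [birkhoffSum_succ, ih, id, hiter, ← map_add]
      congr 1
      ext1 T
      change α.1 (T, n • x) + α.1 (T - n • x, x) = α.1 (T, (n + 1) • x)
      rw [α.2, succ_nsmul]
  have havg : ∀ n : ℕ, birkhoffAverage ℝ (U x) id n (J (A x)) = J (a n) := fun n => by
    rw [birkhoffAverage, hsum, haA, map_smul]
  obtain ⟨Φ, hlim⟩ : ∃ Φ, Tendsto (fun n => J (a n)) atTop (𝓝 Φ) := by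
    simp only [← havg]
    exact ⟨_, (U x).tendsto_birkhoffAverage_orthogonalProjection
      (LinearIsometry.norm_toContinuousLinearMap_le _) (J (A x))⟩
  suffices hΦ : Φ = 0 by rwa [hΦ] at hlim
  -- Invariance holds in every direction, not only along `x`: translating by `y` changes `a n` by
  -- `(α (T - n • x, y) - α (T, y)) / n`, which is uniformly `O(1 / n)`.
  have hinv : ∀ y, U y Φ = Φ := by
    intro y
    have h1 : Tendsto (fun n => U y (J (a n))) atTop (𝓝 (U y Φ)) :=
      ((U y).continuous.tendsto Φ).comp hlim
    have h2 : Tendsto (fun n => (a n).comp (τ y) - a n) atTop (𝓝 0) := by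
      obtain ⟨K, hK⟩ := exists_norm_cocycle_le_of_norm_le α.1 ‖y‖
      have hK0 : 0 ≤ K := (norm_nonneg _).trans (hK (Classical.arbitrary _) y le_rfl)
      refine squeeze_zero_norm (a := fun n : ℕ => (n : ℝ)⁻¹ * (2 * K)) (fun n => ?_) ?_
      · refine (ContinuousMap.norm_le _ (by positivity)).2 fun T => ?_
        have : ((a n).comp (τ y) - a n) T =
            (n : ℝ)⁻¹ • (α.1 (T - n • x, y) - α.1 (T, y)) := by
          change a n (T - y) - a n T = _
          rw [ha, ha, ← smul_sub, cocycle_sub α.2, cocycle_sub α.2, add_comm y]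
          congr 1
          abel
        rw [this, norm_smul, norm_inv, Real.norm_natCast]
        gcongr
        exact (norm_sub_le _ _).trans (by linarith [hK (T - n • x) y le_rfl, hK T y le_rfl])
      · simpa using tendsto_inv_atTop_nhds_zero_nat.mul_const (2 * K)
    have h3 : Tendsto (fun n => J ((a n).comp (τ y) - a n)) atTop (𝓝 0) := by
      have := (J.continuous.tendsto 0).comp h2
      rwa [map_zero] at this
    have h4 : Tendsto (fun n => U y (J (a n))) atTop (𝓝 (0 + Φ)) := by
      refine (h3.add hlim).congr fun n => ?_
      rw [map_sub, hUJ, sub_add_cancel]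
    rw [tendsto_nhds_unique h1 h4, zero_add]
  have hΦint : ∫ T, Φ T ∂μ = 0 := by
    refine ext_inner_left ℝ fun c => ?_
    have key : ∀ f : Lp (Euc d) 2 μ, inner ℝ c (∫ T, f T ∂μ) =
        inner ℝ (indicatorConstLp 2 MeasurableSet.univ (measure_ne_top μ Set.univ) c) f := fun f => by
      rw [L2.inner_indicatorConstLp_eq_inner_setIntegral, setIntegral_univ]
    have hz : ∀ n, ∫ T, (J (a n)) T ∂μ = 0 := fun n => by
      rw [integral_congr_ae (ContinuousMap.coeFn_toLp μ (a n))]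
      simp only [ha]
      rw [integral_smul, integral_cocycle_nsmul hμ.1, h0, smul_zero, smul_zero]
    rw [inner_zero_right, key]
    refine tendsto_nhds_unique ((tendsto_const_nhds (f := atTop)).inner hlim) ?_
    simp only [← key, hz, inner_zero_right]
    exact tendsto_const_nhds
  have hΦi : Integrable Φ μ := (Lp.memLp Φ).integrable (by norm_num)
  have hcoord : ∀ i : Fin d, (fun T => Φ T i) =ᵐ[μ] 0 := by
    intro i
    let π : Euc d →L[ℝ] ℝ := EuclideanSpace.proj i
    refine ae_eq_zero_of_invariant hμ (f := fun T => π (Φ T)) ?_ (π.integrable_comp hΦi)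
      (fun y => ?_) ?_
    · exact π.continuous.measurable.comp (Lp.stronglyMeasurable Φ).measurable
    · have h1 := Lp.coeFn_compMeasurePreserving Φ (hτ y)
      have h2 : Lp.compMeasurePreserving (τ y) (hτ y) Φ = Φ := hinv y
      rw [h2] at h1
      filter_upwards [h1] with T hT
      rw [hT]
      rfl
    · rw [π.integral_comp_comm hΦi, hΦint, map_zero]
  refine Lp.ext ?_
  have hall : ∀ᵐ T ∂μ, ∀ i, Φ T i = 0 := ae_all_iff.2 hcoord
  filter_upwards [hall, Lp.coeFn_zero (Euc d) 2 μ] with T hT hT0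
  rw [hT0]
  ext i
  exact hT i

theorem eq_zero_of_integral_cocycle_eq_zero (hμ : IsUniquelyErgodic μ) (α : weakCocycles Λ) {K : ℝ}
    (hK : 0 < K) (hb : ∀ (T : Hull Λ) (x : Euc d), ‖x‖ ≤ K * (‖α.1 (T, x)‖ + 1)) {x : Euc d}
    (h0 : ∫ T, α.1 (T, x) ∂μ = 0) : x = 0 := by
  by_contra hx
  have hx' : 0 < ‖x‖ := norm_pos_iff.2 hx
  have hprob := hμ.1.isProbability
  have hac : ∀ n : ℕ, Continuous fun T : Hull Λ => α.1 (T, n • x) := fun n =>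
    α.1.continuous.comp (Continuous.prodMk_left (n • x))
  let a : ℕ → C(Hull Λ, Euc d) := fun n =>
    (n : ℝ)⁻¹ • ⟨fun T => α.1 (T, n • x), hac n⟩
  have hlim := (tendsto_toLp_cocycle_nsmul hμ α h0 a fun n T => rfl).norm
  rw [norm_zero] at hlim
  have hn : Tendsto (fun n : ℕ => ‖x‖ / K - (n : ℝ)⁻¹) atTop (𝓝 (‖x‖ / K - 0)) :=
    tendsto_const_nhds.sub tendsto_inv_atTop_nhds_zero_nat
  -- The lower bound `hb` at `n • x`, divided by `n`, holds at every `T` and so bounds the `L²` norm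
  -- from below.
  have hle : ∀ᶠ n : ℕ in atTop, ‖x‖ / K - (n : ℝ)⁻¹ ≤
      ‖ContinuousMap.toLp (E := Euc d) 2 μ ℝ (a n)‖ := by
    filter_upwards [eventually_gt_atTop 0] with n hn0
    have hn0' : (0 : ℝ) < n := Nat.cast_pos.2 hn0
    rcases le_total (‖x‖ / K - (n : ℝ)⁻¹) 0 with hneg | hpos
    · exact hneg.trans (norm_nonneg _)
    have h1 : ‖Lp.const 2 μ (‖x‖ / K - (n : ℝ)⁻¹)‖ = ‖x‖ / K - (n : ℝ)⁻¹ := by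
      rw [Lp.norm_const' _ _ _ two_ne_zero ENNReal.ofNat_ne_top, Real.norm_of_nonneg hpos]
      simp
    rw [← h1]
    refine Lp.norm_le_norm_of_ae_le ?_
    filter_upwards [ContinuousMap.coeFn_toLp (p := 2) (𝕜 := ℝ) μ (a n),
      Lp.coeFn_const 2 μ (‖x‖ / K - (n : ℝ)⁻¹)] with T h2 h3
    rw [h2, h3]
    simp only [Function.const_apply]
    rw [Real.norm_of_nonneg hpos]
    change _ ≤ ‖(n : ℝ)⁻¹ • α.1 (T, n • x)‖
    rw [norm_smul, norm_inv, Real.norm_natCast]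
    have h4 := hb T (n • x)
    rw [← Nat.cast_smul_eq_nsmul ℝ, norm_smul, Real.norm_natCast] at h4
    rw [← Nat.cast_smul_eq_nsmul ℝ, sub_le_iff_le_add, div_le_iff₀ hK]
    have : ‖x‖ = (n : ℝ)⁻¹ * (n * ‖x‖) := by field_simp
    rw [this]
    calc (n : ℝ)⁻¹ * (n * ‖x‖) ≤ (n : ℝ)⁻¹ * (K * (‖α.1 (T, (n : ℝ) • x)‖ + 1)) := by gcongr
      _ = _ := by ring
  have := le_of_tendsto_of_tendsto hn hlim hle
  rw [_root_.sub_zero] at this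
  exact absurd this (not_le.2 (by positivity))

end Compact

end Hull

/-! ### Local maps and strong pattern equivariance. -/

namespace Hull

open Filter

variable {Λ : DeloneSet d X} {Λ' : DeloneSet d Y}

/-- In an aperiodic hull, a translation of bounded length can be read off from patches. -/
theorem exists_translation_determined [CompactSpace X] (haper : IsAperiodic Λ) (M : ℝ) :
    ∃ r > 0, ∀ (S S' : Hull Λ) (u u' : Euc d), ‖u‖ ≤ M → ‖u'‖ ≤ M →
      S.1.patch r = S'.1.patch r → (S - u).1.patch r = (S' - u').1.patch r → u = u' := by
  obtain ⟨ε, hε, hsep⟩ := exists_isSeparatedBy Λ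
  obtain ⟨R₀, hR₀, hcov⟩ := exists_isCoveringBy Λ
  -- By aperiodicity the compact set of pairs `(S - u, S - u')` with `u`, `u'` at least `ε` apart
  -- misses the diagonal. Equal large patches therefore force `‖u - u'‖ < ε`.
  let K : Set (Hull Λ × Euc d × Euc d) :=
    Set.univ ×ˢ ((Metric.closedBall 0 M ×ˢ Metric.closedBall 0 M) ∩ {z | ε ≤ ‖z.1 - z.2‖})
  have hK : IsCompact K := isCompact_univ.prod
    (((isCompact_closedBall _ _).prod (isCompact_closedBall _ _)).inter_right
      (isClosed_le continuous_const (by fun_prop)))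
  let Ψ : Hull Λ × Euc d × Euc d → Hull Λ × Hull Λ := fun z => (z.1 - z.2.1, z.1 - z.2.2)
  have hΨ : Continuous Ψ :=
    (continuous_fst.hullSub (by fun_prop)).prodMk (continuous_fst.hullSub (by fun_prop))
  have hV : (Ψ '' K)ᶜ ∈ uniformity (Hull Λ) := by
    rw [compactSpace_uniformity, mem_iSup]
    intro T
    refine (hK.image hΨ).isClosed.isOpen_compl.mem_nhds ?_
    rintro ⟨⟨S, u, u'⟩, ⟨-, -, huu'⟩, hS⟩
    have h1 : S - u = T := congrArg Prod.fst hS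
    have h2 : S - u' = T := congrArg Prod.snd hS
    have h3 : u = u' := sub_left_cancel haper (h1.trans h2.symm)
    simp only [Set.mem_ofPred_eq, h3, _root_.sub_self, norm_zero] at huu'
    linarith
  obtain ⟨R, hR, hRV⟩ := exists_forall_patch_eq_mem hV
  refine ⟨max R (R₀ + 1) + |M|, by positivity, fun S S' u u' hu hu' hS hSu => ?_⟩
  have h1 : (S - u).1.patch (max R (R₀ + 1)) = (S - u').1.patch (max R (R₀ + 1)) := by
    refine (DeloneSet.patch_mono (by linarith [abs_nonneg M]) hSu).trans ?_
    refine (patch_sub_eq (DeloneSet.patch_mono ?_ hS)).symm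
    linarith [le_abs_self M]
  have h2 : ‖u - u'‖ < ε := by
    by_contra! hcon
    refine hRV _ _ (DeloneSet.patch_mono (le_max_left _ _) h1) ⟨(S, u, u'), ⟨trivial, ⟨?_, ?_⟩, hcon⟩, rfl⟩
    · simpa using hu
    · simpa using hu'
  obtain ⟨p, hp, hpR⟩ := hcov (S - u) 0
  rw [dist_zero_right] at hpR
  have h3 : p ∈ (S - u).1.patch (max R (R₀ + 1)) :=
    ⟨hp, by linarith [le_max_right R (R₀ + 1)]⟩
  have h4 : p ∈ (S - u').1.patch (max R (R₀ + 1)) := h1 ▸ h3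
  -- A common element `p` of the two patches comes from points `p.1 + u` and `p.1 + u'` of `S`, less
  -- than the separation apart, so they agree.
  have h5 := (hsep S).eq (DeloneSet.mem_sub.1 h3.1) (DeloneSet.mem_sub.1 h4.1)
    (by simpa [dist_eq_norm] using h2)
  simpa using congrArg Prod.fst h5

/-- Patches of `T` determine patches of `φ T` and of `φ (T - x)`, which is `φ T` translated by `α
(T, x)`, and hence determine this bounded translation. -/
theorem isUniformlyPE_of_isLocalMap [CompactSpace X] [CompactSpace Y] (haper' : IsAperiodic Λ')
    {φ : Hull Λ → Hull Λ'} (hφ : IsLocalMap φ) {α : C(Hull Λ × Euc d, Euc d)}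
    (hα : IsCocycleOf φ α) : IsUniformlyPE α := by
  intro M
  obtain ⟨K, hK⟩ := exists_norm_cocycle_le_of_norm_le α M
  obtain ⟨r, hr, hdet⟩ := exists_translation_determined haper' K
  obtain ⟨R, hR, hloc⟩ := hφ r hr
  refine ⟨R + |M|, by positivity, fun T T' hT x hx => ?_⟩
  refine hdet (φ T) (φ T') _ _ (hK T x hx) (hK T' x hx)
    (hloc _ _ (DeloneSet.patch_mono (by linarith [abs_nonneg M]) hT)) ?_
  rw [← hα, ← hα]
  exact hloc _ _ (patch_sub_eq (DeloneSet.patch_mono (by linarith [le_abs_self M]) hT))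

theorem isStronglyPE_sub_of_isLocalMap [CompactSpace X] [CompactSpace Y]
    (haper' : IsAperiodic Λ') {h : Hull Λ → Hull Λ'} {s t : C(Hull Λ, Euc d)}
    (hs : IsLocalMap fun T => h T - s T) (ht : IsLocalMap fun T => h T - t T) :
    IsStronglyPE (s - t) := by
  obtain ⟨K, hK⟩ := isCompact_univ.exists_bound_of_continuousOn (s - t).continuous.continuousOn
  obtain ⟨r, hr, hdet⟩ := exists_translation_determined haper' K
  obtain ⟨R, hR, hlocs⟩ := hs r hr
  obtain ⟨R', -, hloct⟩ := ht r hr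
  refine ⟨max R R', lt_max_of_lt_left hR, fun T T' hT => ?_⟩
  refine hdet (h T - t T) (h T' - t T') _ _ (hK T trivial) (hK T' trivial)
    (hloct _ _ (DeloneSet.patch_mono (le_max_right _ _) hT)) ?_
  have := hlocs _ _ (DeloneSet.patch_mono (le_max_left _ _) hT)
  simpa [sub_sub_eq] using this

/-- A continuous choice of a point of `h T`, for `T` in the transversal. -/
theorem exists_continuousOn_point [CompactSpace X] [CompactSpace Y] (hΛ : Λ.IsFLC)
    {h : Hull Λ → Hull Λ'} (hc : Continuous h) :
    ∃ σ : Hull Λ → Euc d, ContinuousOn σ (transversal Λ) ∧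
      ∀ T ∈ transversal Λ, h T - σ T ∈ transversal Λ' := by
  obtain ⟨r, hr, hsep⟩ := exists_isSeparatedBy Λ'
  obtain ⟨R₀, hR₀, hcov⟩ := exists_isCoveringBy Λ'
  have huc := CompactSpace.uniformContinuous_of_continuous hc
  obtain ⟨R, hR, hRV⟩ :=
    exists_forall_patch_eq_mem (huc (mem_uniformity_near (Λ := Λ') (R₀ + 1) (half_pos hr)))
  -- The reference point depends only on the patch, which is locally constant on the transversal
  -- under FLC. This makes the tracked point continuous there.
  have hex : ∀ P : Set (Euc d × X), ∃ p : Euc d, ∀ T ∈ transversal Λ, T.1.patch R = P →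
      ∃ q ∈ (h T).1.points, dist q p < r / 2 := by
    intro P
    by_cases hP : ∃ T₀ : Hull Λ, T₀.1.patch R = P
    · obtain ⟨T₀, rfl⟩ := hP
      obtain ⟨p, hp, hpR⟩ := hcov (h T₀) 0
      rw [dist_zero_right] at hpR
      refine ⟨p.1, fun T _ hT => ?_⟩
      obtain ⟨q, hq, hqp⟩ := hRV _ _ hT.symm p ⟨hp, by linarith⟩
      exact ⟨q.1, ⟨q, hq, rfl⟩, (le_max_left _ _).trans_lt hqp⟩
    · exact ⟨0, fun T _ hT => absurd ⟨T, hT⟩ hP⟩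
  choose p hp using hex
  refine ⟨fun T => (h T).1.nearPoint (r / 2) (p (T.1.patch R)), fun T hT => ?_, fun T hT => ?_⟩
  · have h1 : ContinuousAt (fun S : Hull Λ => (h S).1.nearPoint (r / 2) (p (T.1.patch R))) T :=
      ContinuousAt.comp (f := h)
        (g := fun S : Hull Λ' => S.1.nearPoint (r / 2) (p (T.1.patch R)))
        ((continuousOn_nearPoint hsep (by linarith) _).continuousAt
          ((isOpen_exists_near _ _).mem_nhds (hp _ T hT rfl))) hc.continuousAt
    refine h1.continuousWithinAt.congr_of_eventuallyEq ?_ rfl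
    have h2 := mem_nhds_left T (patch_eq_mem_uniformity_of_isFLC hΛ R)
    filter_upwards [mem_nhdsWithin_of_mem_nhds h2, self_mem_nhdsWithin] with S h3 h4
    rw [← h3 hT h4]
  · exact sub_mem_transversal.2 (DeloneSet.nearPoint_spec (hp _ T hT rfl)).1

/-- `k` is uniformly continuous on the compact transversal, and closeness in the target transversal
is equality of patches by FLC. -/
theorem exists_patch_determines [CompactSpace X] (hΛ' : Λ'.IsFLC) {k : Hull Λ → Hull Λ'}
    (hk : ContinuousOn k (transversal Λ)) (hkm : Set.MapsTo k (transversal Λ) (transversal Λ'))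
    (r : ℝ) : ∃ R > 0, ∀ T ∈ transversal Λ, ∀ T' ∈ transversal Λ, T.1.patch R = T'.1.patch R →
      (k T).1.patch r = (k T').1.patch r := by
  have huc := isClosed_transversal.isCompact.uniformContinuousOn_of_continuous hk
  have hV := mem_inf_principal.1 (huc (patch_eq_mem_uniformity_of_isFLC hΛ' r))
  obtain ⟨R, hR, hRV⟩ := exists_forall_patch_eq_mem hV
  exact ⟨R, hR, fun T hT T' hT' hTT' => hRV T T' hTT' ⟨hT, hT'⟩ (hkm hT) (hkm hT')⟩

end Hull

namespace DeloneSet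

/-- The points of norm less than `R`. -/
def pointsBall (S : DeloneSet d X) (R : ℝ) : Finset (Euc d) :=
  ((S.finite_patch R).image Prod.fst).toFinset

theorem mem_pointsBall {S : DeloneSet d X} {R : ℝ} {p : Euc d} :
    p ∈ S.pointsBall R ↔ p ∈ S.points ∧ ‖p‖ < R := by
  simp only [pointsBall, Set.Finite.mem_toFinset, patch, points]
  constructor
  · rintro ⟨q, hq, rfl⟩
    exact ⟨⟨q, hq.1, rfl⟩, hq.2⟩
  · rintro ⟨⟨q, hq, rfl⟩, hn⟩
    exact ⟨q, ⟨hq, hn⟩, rfl⟩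

theorem pointsBall_eq {S T : DeloneSet d X} {R : ℝ} (h : S.patch R = T.patch R) :
    S.pointsBall R = T.pointsBall R := by
  simp only [pointsBall, h]

end DeloneSet

namespace Hull

open Filter

variable {Λ : DeloneSet d X} {Λ' : DeloneSet d Y}

/-- Near `T` the sum can be indexed by the fixed finite set of points of `T` in a slightly larger
ball. Points crossing the sphere of radius `R` carry weight zero. -/
theorem continuous_sum_pointsBall {E : Type*} [NormedAddCommGroup E] [NormedSpace ℝ E]
    {w : Euc d → ℝ} (hw : Continuous w) {R : ℝ} (hwR : ∀ p, R ≤ ‖p‖ → w p = 0)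
    {f : Hull Λ × Euc d → E} (hf : ContinuousOn f {z | z.2 ∈ z.1.1.points}) :
    Continuous fun T : Hull Λ => ∑ p ∈ T.1.pointsBall R, w p • f (T, p) := by
  classical
  obtain ⟨r, hr, hsep⟩ := exists_isSeparatedBy Λ
  set η := min (r / 2) 1
  have hη : 0 < η := by positivity
  have hηr : 2 * η ≤ r := by linarith [min_le_left (r / 2) 1]
  refine continuous_iff_continuousAt.2 fun T => ?_
  have hnear : ∀ᶠ S : Hull Λ in 𝓝 T, ∀ p ∈ T.1.pointsBall (R + 1),
      ∃ q ∈ S.1.points, dist q p < η :=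
    (T.1.pointsBall (R + 1)).eventually_all.2 fun p hp =>
      eventually_near_points T (DeloneSet.mem_pointsBall.1 hp).1 hη
  have hnear' := mem_nhds_left T (UniformSpace.symm (mem_uniformity_near (Λ := Λ) R hη))
  have heq : ∀ᶠ S : Hull Λ in 𝓝 T,
      ∑ p ∈ T.1.pointsBall (R + 1), w (S.1.nearPoint η p) • f (S, S.1.nearPoint η p) =
        ∑ p ∈ S.1.pointsBall R, w p • f (S, p) := by
    filter_upwards [hnear, hnear'] with S hS hS'
    have hinj : Set.InjOn (fun p => S.1.nearPoint η p) (T.1.pointsBall (R + 1)) := by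
      intro p hp q hq hpq
      refine (hsep T).points_eq (DeloneSet.mem_pointsBall.1 hp).1
        (DeloneSet.mem_pointsBall.1 hq).1 ?_
      have h1 := (DeloneSet.nearPoint_spec (hS p hp)).2
      have h2 := (DeloneSet.nearPoint_spec (hS q hq)).2
      simp only at hpq
      rw [hpq] at h1
      have h3 := dist_triangle_left p q (S.1.nearPoint η q)
      linarith
    rw [← Finset.sum_image (f := fun q => w q • f (S, q)) hinj]
    symm
    refine Finset.sum_subset (fun q hq => ?_) fun q hq hqn => ?_
    · obtain ⟨⟨q, hqS, rfl⟩, hqR⟩ := DeloneSet.mem_pointsBall.1 hq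
      obtain ⟨p, hp, hpq⟩ := hS' q ⟨hqS, hqR⟩
      have h1 : dist p.1 q.1 < η := (le_max_left _ _).trans_lt hpq
      refine Finset.mem_image.2 ⟨p.1, DeloneSet.mem_pointsBall.2 ⟨⟨p, hp, rfl⟩, ?_⟩, ?_⟩
      · have h2 := norm_le_norm_add_norm_sub' p.1 q.1
        rw [← dist_eq_norm] at h2
        linarith [min_le_right (r / 2) 1]
      · exact (hsep S).nearPoint_eq hηr ⟨q, hqS, rfl⟩ (by rwa [dist_comm])
    · obtain ⟨p, hp, rfl⟩ := Finset.mem_image.1 hq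
      have h1 := (DeloneSet.nearPoint_spec (hS p hp)).1
      rw [hwR, zero_smul]
      by_contra! hlt
      exact hqn (DeloneSet.mem_pointsBall.2 ⟨h1, hlt⟩)
  refine ContinuousAt.congr ?_ heq
  refine tendsto_finsetSum _ fun p hp => ?_
  have hpT := (DeloneSet.mem_pointsBall.1 hp).1
  have hset : ∃ q ∈ T.1.points, dist q p < η := ⟨p, hpT, by simpa using hη⟩
  have hc : ContinuousAt (fun S : Hull Λ => S.1.nearPoint η p) T :=
    (continuousOn_nearPoint hsep hηr p).continuousAt ((isOpen_exists_near _ _).mem_nhds hset)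
  have hcf : Tendsto (fun S : Hull Λ => f (S, S.1.nearPoint η p)) (𝓝 T)
      (𝓝 (f (T, T.1.nearPoint η p))) := by
    refine Tendsto.comp (y := 𝓝[{z | z.2 ∈ z.1.1.points}] (T, T.1.nearPoint η p))
      (hf _ (DeloneSet.nearPoint_spec hset).1) ?_
    refine tendsto_nhdsWithin_iff.2 ⟨continuousAt_id.prodMk hc, ?_⟩
    filter_upwards [(isOpen_exists_near (Λ := Λ) η p).mem_nhds hset] with S hS
    exact (DeloneSet.nearPoint_spec hS).1
  exact (hw.continuousAt.comp hc).smul hcf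

/-- If both hulls have finite local complexity, then a continuous map with a cocycle becomes local
after composition with a continuous family of translations. -/
theorem exists_isLocalMap [CompactSpace X] [CompactSpace Y] (haper' : IsAperiodic Λ')
    (hΛ : Λ.IsFLC) (hΛ' : Λ'.IsFLC) {h : Hull Λ → Hull Λ'} (hc : Continuous h)
    {α : C(Hull Λ × Euc d, Euc d)} (hα : IsCocycleOf h α) :
    ∃ s : C(Hull Λ, Euc d), IsLocalMap fun T => h T - s T := by
  obtain ⟨σ, hσ, hσm⟩ := exists_continuousOn_point hΛ hc
  obtain ⟨R₀, hR₀, hcov⟩ := exists_isCoveringBy Λ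
  have hkc : ContinuousOn (fun T => h T - σ T) (transversal Λ) := hc.continuousOn.hullSub hσ
  have hkloc := exists_patch_determines hΛ' hkc hσm
  -- For a point `p` of `T`, this takes `h T` to the recentred image of `T - p`, which patches of
  -- `T` around `p` determine.
  let a : Hull Λ × Euc d → Euc d := fun z => α z + σ (z.1 - z.2)
  have hka : ∀ (T : Hull Λ) (p : Euc d), h (T - p) - σ (T - p) = h T - a (T, p) := fun T p => by
    rw [hα, sub_sub_eq]
  have hac : ContinuousOn a {z | z.2 ∈ z.1.1.points} :=
    α.continuous.continuousOn.add (hσ.comp continuous_sub.continuousOn fun z hz =>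
      sub_mem_transversal.2 hz)
  obtain ⟨Kσ, hKσ⟩ := isClosed_transversal.isCompact.exists_bound_of_continuousOn hσ
  obtain ⟨Kα, hKα⟩ := exists_norm_cocycle_le_of_norm_le α (R₀ + 1)
  have hKa : ∀ (T : Hull Λ), ∀ p ∈ T.1.points, ‖p‖ ≤ R₀ + 1 → ‖a (T, p)‖ ≤ Kα + Kσ :=
    fun T p hp hpR => (norm_add_le _ _).trans
      (add_le_add (hKα T p hpR) (hKσ _ (sub_mem_transversal.2 hp)))
  obtain ⟨R₁, hR₁, hdiff⟩ : ∃ R > 0, ∀ T T' : Hull Λ, T.1.patch R = T'.1.patch R →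
      ∀ p ∈ T.1.points, ∀ q ∈ T.1.points, p ∈ T'.1.points → q ∈ T'.1.points →
        ‖p‖ ≤ R₀ + 1 → ‖q‖ ≤ R₀ + 1 → a (T, q) - a (T, p) = a (T', q) - a (T', p) := by
    obtain ⟨r, hr, hdet⟩ := exists_translation_determined haper' (2 * (Kα + Kσ))
    obtain ⟨R, hR, hloc⟩ := hkloc r
    refine ⟨R + (R₀ + 1), by positivity, fun T T' hT p hp q hq hp' hq' hpR hqR => ?_⟩
    have hpatch : ∀ x ∈ T.1.points, x ∈ T'.1.points → ‖x‖ ≤ R₀ + 1 →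
        (h T - a (T, x)).1.patch r = (h T' - a (T', x)).1.patch r := by
      intro x hx hx' hxR
      rw [← hka, ← hka]
      exact hloc _ (sub_mem_transversal.2 hx) _ (sub_mem_transversal.2 hx')
        (patch_sub_eq (DeloneSet.patch_mono (by linarith) hT))
    refine hdet (h T - a (T, p)) (h T' - a (T', p)) _ _ ?_ ?_ (hpatch p hp hp' hpR) ?_
    · exact (norm_sub_le _ _).trans (by linarith [hKa T p hp hpR, hKa T q hq hqR])
    · exact (norm_sub_le _ _).trans (by linarith [hKa T' p hp' hpR, hKa T' q hq' hqR])
    · rw [sub_sub_eq, sub_sub_eq, add_sub_cancel, add_sub_cancel]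
      exact hpatch q hq hq' hqR
  -- The weight is positive on the closed ball of radius `R₀`, which contains a point of every `T`,
  -- so the total weight `W` never vanishes.
  let w : Euc d → ℝ := fun p => max 0 (R₀ + 1 - ‖p‖)
  have hw : Continuous w := by fun_prop
  have hwR : ∀ p, R₀ + 1 ≤ ‖p‖ → w p = 0 := fun p hp => max_eq_left (by linarith)
  let W : Hull Λ → ℝ := fun T => ∑ p ∈ T.1.pointsBall (R₀ + 1), w p
  have hWc : Continuous W := by
    have := continuous_sum_pointsBall (Λ := Λ) hw hwR (f := fun _ => (1 : ℝ)) continuousOn_const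
    simpa using this
  have hW : ∀ T, 0 < W T := fun T => by
    obtain ⟨p, hp, hpR⟩ := hcov T 0
    rw [dist_zero_right] at hpR
    refine Finset.sum_pos' (fun q _ => le_max_left _ _)
      ⟨p.1, DeloneSet.mem_pointsBall.2 ⟨⟨p, hp, rfl⟩, by linarith⟩, lt_max_of_lt_right (by linarith)⟩
  let s : C(Hull Λ, Euc d) :=
    ⟨fun T => (W T)⁻¹ • ∑ p ∈ T.1.pointsBall (R₀ + 1), w p • a (T, p),
      (hWc.inv₀ fun T => (hW T).ne').smul (continuous_sum_pointsBall hw hwR hac)⟩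
  -- Relative to one point `p`, the average `s` involves only differences of `a`, which are local by
  -- `hdiff`.
  have hsa : ∀ (T : Hull Λ) (p : Euc d), s T - a (T, p) =
      (W T)⁻¹ • ∑ q ∈ T.1.pointsBall (R₀ + 1), w q • (a (T, q) - a (T, p)) := by
    intro T p
    simp only [smul_sub, Finset.sum_sub_distrib, ← Finset.sum_smul]
    rw [smul_smul, inv_mul_cancel₀ (hW T).ne', one_smul]
    rfl
  obtain ⟨Ks, hKs⟩ := isCompact_univ.exists_bound_of_continuousOn s.continuous.continuousOn
  refine ⟨s, fun r hr => ?_⟩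
  obtain ⟨R₂, hR₂, hloc⟩ := hkloc (r + (Ks + (Kα + Kσ)))
  refine ⟨max R₁ (R₂ + (R₀ + 1)), lt_max_of_lt_left hR₁, fun T T' hT => ?_⟩
  have hball : T.1.pointsBall (R₀ + 1) = T'.1.pointsBall (R₀ + 1) :=
    DeloneSet.pointsBall_eq (DeloneSet.patch_mono
      (le_trans (by linarith) (le_max_right R₁ (R₂ + (R₀ + 1)))) hT)
  have hWW : W T = W T' := by simp only [W, hball]
  obtain ⟨⟨p, l⟩, hp, hpR⟩ := hcov T 0
  rw [dist_zero_right] at hpR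
  have hpT : p ∈ T.1.pointsBall (R₀ + 1) :=
    DeloneSet.mem_pointsBall.2 ⟨⟨_, hp, rfl⟩, by simp only at hpR; linarith⟩
  have hpT' : p ∈ T'.1.pointsBall (R₀ + 1) := hball ▸ hpT
  rw [DeloneSet.mem_pointsBall] at hpT hpT'
  have hb : s T - a (T, p) = s T' - a (T', p) := by
    rw [hsa, hsa, hWW, hball]
    congr 1
    refine Finset.sum_congr rfl fun q hq' => ?_
    have hq : q ∈ T.1.pointsBall (R₀ + 1) := hball ▸ hq'
    rw [DeloneSet.mem_pointsBall] at hq hq'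
    rw [hdiff T T' (DeloneSet.patch_mono (le_max_left _ _) hT) p hpT.1 q hq.1 hpT'.1 hq'.1
      hpT.2.le hq.2.le]
  have hsub : ∀ S : Hull Λ, h S - s S = h (S - p) - σ (S - p) - (s S - a (S, p)) := fun S => by
    rw [hka, sub_sub_eq, add_sub_cancel]
  simp only [hsub]
  rw [← hb]
  refine patch_sub_eq (DeloneSet.patch_mono (R := r + (Ks + (Kα + Kσ))) ?_ ?_)
  · have := (norm_sub_le (s T) (a (T, p))).trans
      (add_le_add (hKs T trivial) (hKa T p hpT.1 hpT.2.le))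
    linarith
  · refine hloc _ (sub_mem_transversal.2 hpT.1) _ (sub_mem_transversal.2 hpT'.1)
      (patch_sub_eq (DeloneSet.patch_mono ?_ hT))
    exact le_trans (by linarith [hpT.2]) (le_max_right R₁ (R₂ + (R₀ + 1)))

end Hull

/-! ### The Ruelle–Sullivan matrix and the strong class. -/

namespace Hull

open Filter

variable {Λ : DeloneSet d X} {Λ' : DeloneSet d Y} {μ : Measure (Hull Λ)}

/-- The matrix of `x ↦ ∫ α(T, x) dμ(T)` on the standard basis. -/
def cocycleAverage (μ : Measure (Hull Λ)) (α : weakCocycles Λ) : Matrix (Fin d) (Fin d) ℝ :=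
  Matrix.of fun i j => (∫ T, α.1 (T, EuclideanSpace.single j 1) ∂μ) i

theorem integral_addCoboundary [CompactSpace X] (hμ : IsInvariantProbability μ)
    (α : weakCocycles Λ) (s : C(Hull Λ, Euc d)) (x : Euc d) :
    ∫ T, (addCoboundary α s).1 (T, x) ∂μ = ∫ T, α.1 (T, x) ∂μ := by
  have := hμ.isProbability
  have h1 : Continuous fun T : Hull Λ => α.1 (T, x) :=
    α.1.continuous.comp (Continuous.prodMk_left x)
  have h2 : Continuous fun T : Hull Λ => s (T - x) - s T :=
    (s.continuous.comp (continuous_sub_right x)).sub s.continuous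
  simp only [addCoboundary_apply]
  rw [integral_add (integrable_of_continuous h1) (integrable_of_continuous h2),
    integral_coboundary hμ, add_zero]

theorem average_eq_cocycleAverage [CompactSpace X] (hμ : IsInvariantProbability μ) {η : PEForm Λ}
    {α : weakCocycles Λ} {s : C(Hull Λ, Euc d)} (hη : η.HasPrimitive (addCoboundary α s).1) :
    η.average μ = cocycleAverage μ α := by
  have := hμ.isProbability
  ext i j
  have h1 : Continuous fun T : Hull Λ => η.toFun T (EuclideanSpace.single j 1) :=
    η.continuous.clm_apply continuous_const
  simp only [PEForm.average, cocycleAverage, Matrix.of_apply]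
  rw [← integral_addCoboundary hμ α s, ← integral_form_apply hμ η hη]
  exact (EuclideanSpace.proj (𝕜 := ℝ) i).integral_comp_comm (integrable_of_continuous h1)

/-- Linearity of `x ↦ ∫ α (T, x) dμ` comes from a smooth representative: the map is evaluation of `∫
η dμ` at `x`. -/
theorem mulVec_cocycleAverage [CompactSpace X] (hμ : IsInvariantProbability μ)
    (α : weakCocycles Λ) (x : Euc d) :
    (cocycleAverage μ α).mulVec x.ofLp = (∫ T, α.1 (T, x) ∂μ).ofLp := by
  have := hμ.isProbability
  obtain ⟨η, s, hη, -⟩ := exists_smooth_cohomologous α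
  have key : ∀ y : Euc d, ∫ T, α.1 (T, y) ∂μ = (∫ T, η.toFun T ∂μ) y := fun y => by
    rw [← integral_addCoboundary hμ α s, ← integral_form_apply hμ η hη,
      ContinuousLinearMap.integral_apply (integrable_of_continuous η.continuous)]
  funext i
  have hx : x = ∑ j, x j • EuclideanSpace.single j (1 : ℝ) := by
    simpa using ((EuclideanSpace.basisFun (Fin d) ℝ).sum_repr x).symm
  have : (∫ T, α.1 (T, x) ∂μ) i =
      ∑ j, x j * (∫ T, α.1 (T, EuclideanSpace.single j 1) ∂μ) i := by
    simp only [key]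
    conv_lhs => rw [hx]
    simp [map_sum]
  rw [this]
  simp only [Matrix.mulVec, dotProduct, cocycleAverage, Matrix.of_apply, mul_comm]

theorem isUnit_cocycleAverage [CompactSpace X] (hμ : IsUniquelyErgodic μ) (α : weakCocycles Λ)
    {K : ℝ} (hK : 0 < K) (hb : ∀ (T : Hull Λ) (x : Euc d), ‖x‖ ≤ K * (‖α.1 (T, x)‖ + 1)) :
    IsUnit (cocycleAverage μ α) := by
  rw [← Matrix.mulVec_injective_iff_isUnit]
  refine (injective_iff_map_eq_zero (Matrix.mulVecLin (cocycleAverage μ α))).2 fun v hv => ?_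
  rw [Matrix.mulVecLin_apply] at hv
  have h1 := mulVec_cocycleAverage hμ.1 α (WithLp.toLp 2 v)
  rw [WithLp.ofLp_toLp, hv] at h1
  have h2 : ∫ T, α.1 (T, WithLp.toLp 2 v) ∂μ = 0 := by
    ext i
    exact (congrFun h1 i).symm
  simpa using eq_zero_of_integral_cocycle_eq_zero hμ α hK hb h2

theorem isRuelleSullivanWeak_cocycleAverage [CompactSpace X] (hμ : IsInvariantProbability μ)
    (α : weakCocycles Λ) :
    IsRuelleSullivanWeak μ (QuotientAddGroup.mk α) (cocycleAverage μ α) := by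
  constructor
  · obtain ⟨η, s, hη, -⟩ := exists_smooth_cohomologous α
    refine ⟨η, addCoboundary α s, hη, QuotientAddGroup.eq.2 ⟨-s, fun T v => ?_⟩⟩
    change -(addCoboundary α s).1 (T, v) + α.1 (T, v) = -s (T - v) - -s T
    rw [addCoboundary_apply]
    abel
  · rintro η ⟨β, hη, hβ⟩
    obtain ⟨s, hs⟩ := QuotientAddGroup.eq.1 hβ
    refine average_eq_cocycleAverage (s := -s) hμ fun T x => ?_
    refine (hη T x).congr_of_eventuallyEq (Eventually.of_forall fun v => ?_)
    have : -β.1 (T, v) + α.1 (T, v) = s (T - v) - s T := hs T v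
    change α.1 (T, v) + (-s (T - v) - -s T) = β.1 (T, v)
    rw [sub_neg_eq_add, neg_add_eq_sub, ← neg_sub (s (T - v)), ← this]
    abel

/-- Uniform pattern equivariance of `γ` lets smoothing stay within the strong class. For the
averages only the weak class matters, and there `γ` agrees with `α`. -/
theorem isRuelleSullivanStrong_cocycleAverage [CompactSpace X] (hμ : IsInvariantProbability μ)
    (α : weakCocycles Λ) (s : C(Hull Λ, Euc d)) (γ : strongCocycles Λ)
    (hγ : γ.1 = (addCoboundary α s).1) (hγ' : IsUniformlyPE γ.1) :
    IsRuelleSullivanStrong μ (QuotientAddGroup.mk γ) (cocycleAverage μ α) := by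
  constructor
  · obtain ⟨η, t, hη, hPE⟩ := exists_smooth_cohomologous ⟨γ.1, γ.2.1⟩
    obtain ⟨ht, hη'⟩ := hPE hγ'
    refine ⟨η, hη', ⟨(addCoboundary ⟨γ.1, γ.2.1⟩ t).1, (addCoboundary ⟨γ.1, γ.2.1⟩ t).2,
      fun v => (γ.2.2 v).comp₂ ((ht.sub v).comp₂ ht (· - ·)) (· + ·)⟩, hη,
      QuotientAddGroup.eq.2 ⟨-t, ht.comp (- ·), fun T v => ?_⟩⟩
    change -(γ.1 (T, v) + (t (T - v) - t T)) + γ.1 (T, v) = -t (T - v) - -t T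
    abel
  · rintro η ⟨-, β, hη, hβ⟩
    obtain ⟨t, -, ht⟩ := QuotientAddGroup.eq.1 hβ
    refine average_eq_cocycleAverage (s := s - t) hμ fun T x => ?_
    refine (hη T x).congr_of_eventuallyEq (Eventually.of_forall fun v => ?_)
    have h1 : -β.1 (T, v) + γ.1 (T, v) = t (T - v) - t T := ht T v
    rw [hγ, addCoboundary_apply] at h1
    change α.1 (T, v) + ((s (T - v) - t (T - v)) - (s T - t T)) = β.1 (T, v)
    rw [neg_add_eq_sub, sub_eq_iff_eq_add] at h1
    rw [← sub_eq_iff_eq_add'.2 h1]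
    abel

theorem isCocycleOf_addCoboundary {h : Hull Λ → Hull Λ'} {α : weakCocycles Λ}
    (hα : IsCocycleOf h α.1) (s : C(Hull Λ, Euc d)) :
    IsCocycleOf (fun T => h T - s T) (addCoboundary α s).1 := fun T x => by
  rw [addCoboundary_apply]
  simp only
  rw [hα, sub_sub_eq, sub_sub_eq]
  congr 1
  abel

theorem exists_strongClass [CompactSpace X] [CompactSpace Y] (haper' : IsAperiodic Λ')
    (hμ : IsInvariantProbability μ) (hΛ : Λ.IsFLC) (hΛ' : Λ'.IsFLC) (h : Hull Λ ≃ₜ Hull Λ')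
    {α : weakCocycles Λ} (hα : IsCocycleOf h α.1) :
    ∃ c : StrongH1 Λ, IsStrongClassOf h c ∧ (∀ c', IsStrongClassOf h c' → c' = c) ∧
      IsRuelleSullivanStrong μ c (cocycleAverage μ α) := by
  obtain ⟨s, hs⟩ := exists_isLocalMap haper' hΛ hΛ' h.continuous hα
  have hcoc := isCocycleOf_addCoboundary hα s
  have hPE := isUniformlyPE_of_isLocalMap haper' hs hcoc
  let γ : strongCocycles Λ := ⟨(addCoboundary α s).1, (addCoboundary α s).2, fun v => by
    obtain ⟨R, hR, hR'⟩ := hPE ‖v‖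
    exact ⟨R, hR, fun T T' hT => hR' T T' hT v le_rfl⟩⟩
  refine ⟨QuotientAddGroup.mk γ, ⟨s, hs, γ, hcoc, rfl⟩, ?_,
    isRuelleSullivanStrong_cocycleAverage hμ α s γ rfl hPE⟩
  rintro _ ⟨t, ht, β, hβ, rfl⟩
  refine QuotientAddGroup.eq.2 ⟨s - t, isStronglyPE_sub_of_isLocalMap haper' hs ht,
    fun T v => ?_⟩
  have hβ' := isCocycleOf_unique haper' hβ (isCocycleOf_addCoboundary hα t)
  change -β.1 (T, v) + (α.1 (T, v) + (s (T - v) - s T)) = (s (T - v) - t (T - v)) - (s T - t T)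
  rw [hβ', addCoboundary_apply]
  abel

end Hull

end Tiling

end

theorem mainTheorem3 {d : ℕ} {X Y : Type*} [MetricSpace X] [CompactSpace X]
    [MetricSpace Y] [CompactSpace Y]
    (Λ : Tiling.DeloneSet d X) (Λ' : Tiling.DeloneSet d Y)
    (hmin : Tiling.IsMinimal Λ) (hmin' : Tiling.IsMinimal Λ')
    (haper : Tiling.IsAperiodic Λ) (haper' : Tiling.IsAperiodic Λ')
    (μ : MeasureTheory.Measure (Tiling.Hull Λ)) (hμ : Tiling.IsUniquelyErgodic μ)
    (h : Tiling.Hull Λ ≃ₜ Tiling.Hull Λ')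
    (hh : Tiling.IsOrbitEquivalence h ∨ (Λ.IsFLC ∧ Λ'.IsFLC)) :
    ∃ C : Matrix (Fin d) (Fin d) ℝ, IsUnit C ∧
      (∃ c : Tiling.WeakH1 Λ, Tiling.IsWeakClassOf h c ∧
        (∀ c', Tiling.IsWeakClassOf h c' → c' = c) ∧ Tiling.IsRuelleSullivanWeak μ c C) ∧
      (Λ.IsFLC → Λ'.IsFLC →
        ∃ c : Tiling.StrongH1 Λ, Tiling.IsStrongClassOf h c ∧
          (∀ c', Tiling.IsStrongClassOf h c' → c' = c) ∧ Tiling.IsRuelleSullivanStrong μ c C) := by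
  obtain ⟨⟨α, hα⟩, β, hβ⟩ := Tiling.Hull.exists_cocycles_of_homeomorph haper haper' h hh
  obtain ⟨K, hK, hb⟩ := Tiling.Hull.exists_norm_le_cocycle haper h hα β hβ
  refine ⟨Tiling.Hull.cocycleAverage μ α, Tiling.Hull.isUnit_cocycleAverage hμ α hK hb,
    ⟨QuotientAddGroup.mk α, ⟨α, hα, rfl⟩, ?_,
      Tiling.Hull.isRuelleSullivanWeak_cocycleAverage hμ.1 α⟩,
    fun hΛ hΛ' => Tiling.Hull.exists_strongClass haper' hμ.1 hΛ hΛ' h hα⟩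
  rintro _ ⟨α', hα', rfl⟩
  rw [Subtype.ext (Tiling.Hull.isCocycleOf_unique haper' hα' hα)]
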